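/- Let $F$ be a germ at $0$ of a holomorphic diffeomorphism of $\mathbb C^n$ ($n\ge 1$) with $F(0)=0$, whose differential $dF_0$ is diagonal with diagonal entries $\lambda_1,\dots,\lambda_n$. Suppose that $\lambda_1$ is a primitive $q$-th root of unity, $q\ge 1$, and that $|\lambda_j|<1$ for $j=2,\dots,n$. Then $F$ is one-resonant with respect to $\lambda_1$ with index of resonance $\alpha=(q,0,\dots,0)$: for multi-indices $l\in\mathbb N^n$ with $|l|\ge 2$, one has $\lambda_1=\lambda_1^{l_1}\cdots\lambda_n^{l_n}$ exactly when $l=s\alpha+e_1$ for some integer $s\ge1$. We say that $F$ is formally linearizable in the first component if it is conjugate, by a formal change of coordinates fixing $0$ with invertible linear part, to a formal map $G$ with $G_1(z)=\lambda_1z_1$. The order $k\in\{1,2,\dots\}\cup\{\infty\}$ of $F$ with respect to $\lambda_1$ is the integer $k\ge1$ such that $F$ is formally conjugate to a formal map $G$ with $G_1(z)=\lambda_1z_1+a\,z_1^{qk+1}+O(|z|^{qk+2})$, $a\neq0$, and $k=\infty$ if there is no such integer; there is at most one such integer, so $k$ is well defined. A basin of attraction for $F$ at $0$ is a non-empty open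 set $U\subset\mathbb C^n$ with $0\in\overline U$ for which there is a neighbourhood basis $\{\Omega_i\}$ of $0$ such that $F(U\cap\Omega_i)\subset U\cap\Omega_i$ for all $i$ and $F^{\circ m}(z)\to0$ as $m\to\infty$ for all $z\in U\cap\Omega_i$. Then: 1. If $k<\infty$, there exist $k$ pairwise disjoint basins of attraction for $F$ at $0$, having $0$ on their boundary, each with exactly $q$ connected components $D_0,\dots,D_{q-1}$, which $F$ permutes cyclically: $F(D_p)\subset D_{p+1}$ for $0\le p\le q-1$, where $D_q=D_0$. 2. $k=\infty$ if and only if $F$ is formally linearizable in the first component, and this is the case if and only if there is a germ of a non-singular holomorphic curve through $0$ consisting of fixed points of $F^{\circ q}$. -/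

import Mathlib

open Filter Topology Set

/-- `F` represents a germ at `0` of a holomorphic diffeomorphism of `ℂⁿ` fixing `0`. -/
def IsDiffGerm {n : ℕ} (F : (Fin n → ℂ) → (Fin n → ℂ)) : Prop :=
  AnalyticAt ℂ F 0 ∧ F 0 = 0 ∧
    ∃ G : (Fin n → ℂ) → (Fin n → ℂ), AnalyticAt ℂ G 0 ∧ G 0 = 0 ∧
      ∀ᶠ z in 𝓝 (0 : Fin n → ℂ), G (F z) = z ∧ F (G z) = z

/-- The resonances among `lam`: the pairs `(j, l)` with `|l| ≥ 2` and `lam j = lam ^ l`. -/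
def IsResonance {n : ℕ} (lam : Fin n → ℂ) (j : Fin n) (l : Fin n →₀ ℕ) : Prop :=
  2 ≤ l.degree ∧ lam j = l.prod fun i e => lam i ^ e

/-- One-resonance with respect to the first `m` eigenvalues, with index of resonance `α`. -/
def IsOneResonant {n : ℕ} (lam : Fin n → ℂ) (m : ℕ) (α : Fin n →₀ ℕ) : Prop :=
  α ≠ 0 ∧ (∀ j : Fin n, m ≤ j.val → α j = 0) ∧
    ∀ j : Fin n, j.val < m → ∀ l : Fin n →₀ ℕ,
      IsResonance lam j l ↔ ∃ k : ℕ, 1 ≤ k ∧ l = k • α + Finsupp.single j 1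

/-- The components of `f` are the power series expansions at `0` of the components of `F`. -/
def HasTaylorSeries {n : ℕ} (F : (Fin n → ℂ) → (Fin n → ℂ))
    (f : Fin n → MvPowerSeries (Fin n) ℂ) : Prop :=
  ∀ᶠ z in 𝓝 (0 : Fin n → ℂ), ∀ j : Fin n,
    HasSum (fun d : Fin n →₀ ℕ => MvPowerSeries.coeff d (f j) * d.prod fun i e => z i ^ e) (F z j)

/-- A formal change of coordinates: no constant term and invertible linear part. -/
def IsFormalDiff {n : ℕ} (Φ : Fin n → MvPowerSeries (Fin n) ℂ) : Prop :=
  (∀ j, MvPowerSeries.constantCoeff (Φ j) = 0) ∧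
    IsUnit (Matrix.of fun i j : Fin n => MvPowerSeries.coeff (Finsupp.single j 1) (Φ i))

/-- `F` is formally conjugate to `G`: `Φ ∘ F = G ∘ Φ` for some formal change of coordinates. -/
def FormallyConjugate {n : ℕ} (F : (Fin n → ℂ) → (Fin n → ℂ))
    (G : Fin n → MvPowerSeries (Fin n) ℂ) : Prop :=
  ∃ f Φ : Fin n → MvPowerSeries (Fin n) ℂ, HasTaylorSeries F f ∧ IsFormalDiff Φ ∧
    ∀ j, MvPowerSeries.subst f (Φ j) = MvPowerSeries.subst Φ (G j)

/-- `F` is formally conjugate to some `G` with `G_j(z) = lam_j z_j` for the first `m` indices. -/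
def FormallyLinearizable {n : ℕ} (F : (Fin n → ℂ) → (Fin n → ℂ)) (lam : Fin n → ℂ) (m : ℕ) :
    Prop :=
  ∃ G : Fin n → MvPowerSeries (Fin n) ℂ, FormallyConjugate F G ∧
    ∀ j : Fin n, j.val < m → G j = MvPowerSeries.monomial (Finsupp.single j 1) (lam j)

/-- `F` is formally conjugate to some `G` with
`G_j(z) = lam_j z_j + a_j z^(kα) z_j + O(|z|^(|α| k + 2))` for the first `m` indices,
where `k ≥ 1` and `(a_1, …, a_m) ≠ 0`. -/
def HasResonantForm {n : ℕ} (F : (Fin n → ℂ) → (Fin n → ℂ)) (lam : Fin n → ℂ) (m : ℕ)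
    (α : Fin n →₀ ℕ) (k : ℕ) : Prop :=
  1 ≤ k ∧ ∃ G : Fin n → MvPowerSeries (Fin n) ℂ, FormallyConjugate F G ∧
    ∃ a : Fin n → ℂ, (∃ j : Fin n, j.val < m ∧ a j ≠ 0) ∧
      ∀ j : Fin n, j.val < m → ∀ d : Fin n →₀ ℕ, d.degree < α.degree * k + 2 →
        MvPowerSeries.coeff d (G j) =
          MvPowerSeries.coeff d (MvPowerSeries.monomial (Finsupp.single j 1) (lam j) +
            MvPowerSeries.monomial (k • α + Finsupp.single j 1) (a j))

/-- The order of `F` with respect to the first `m` eigenvalues: the number `k` of the resonant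
form of `F`, and `⊤` if there is no such form. -/
noncomputable def resonanceOrder {n : ℕ} (F : (Fin n → ℂ) → (Fin n → ℂ)) (lam : Fin n → ℂ)
    (m : ℕ) (α : Fin n →₀ ℕ) : ℕ∞ :=
  sInf {x : ℕ∞ | ∃ k : ℕ, HasResonantForm F lam m α k ∧ x = k}

/-- `U` is a basin of attraction for `F` at `0`. -/
def IsBasin {n : ℕ} (F : (Fin n → ℂ) → (Fin n → ℂ)) (U : Set (Fin n → ℂ)) : Prop :=
  U.Nonempty ∧ IsOpen U ∧ (0 : Fin n → ℂ) ∈ closure U ∧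
    ∃ S : Set (Set (Fin n → ℂ)), (𝓝 (0 : Fin n → ℂ)).HasBasis (fun Ω => Ω ∈ S) id ∧
      ∀ Ω ∈ S, MapsTo F (U ∩ Ω) (U ∩ Ω) ∧
        ∀ z ∈ U ∩ Ω, Tendsto (fun i : ℕ => F^[i] z) atTop (𝓝 0)

/-- `U` has exactly `q` connected components, and `F` permutes them cyclically
(meant for `q ≥ 1`). -/
def PermutesComponentsCyclically {n : ℕ} (F : (Fin n → ℂ) → (Fin n → ℂ)) (q : ℕ)
    (U : Set (Fin n → ℂ)) : Prop :=
  ∃ D : ZMod q → Set (Fin n → ℂ), Function.Injective D ∧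
    range D = {C | ∃ x ∈ U, C = connectedComponentIn U x} ∧
    ∀ p : ZMod q, MapsTo F (D p) (D (p + 1))

/-- There is a germ of a non-singular holomorphic curve through `0` of fixed points of `F`. -/
def HasFixedCurve {n : ℕ} (F : (Fin n → ℂ) → (Fin n → ℂ)) : Prop :=
  ∃ γ : ℂ → (Fin n → ℂ), AnalyticAt ℂ γ 0 ∧ γ 0 = 0 ∧ deriv γ 0 ≠ 0 ∧
    ∀ᶠ t in 𝓝 (0 : ℂ), F (γ t) = γ t

/-! Only the first coordinate has to be normalised. Composition with `f` acts on coefficients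
triangularly in the degree, with diagonal entries `λ^d`. One series `φ` tangent to the first
coordinate can therefore be solved for recursively so that `φ ∘ f - λ₁ φ` contains only resonant
monomials. Taking norms shows that the resonances are `z₁^(qs+1)`. Either the remainder vanishes,
which gives formal linearizability, or its lowest term is `a z₁^(qk+1)`, which gives a resonant form
(`formallyLinearizable_or_hasResonantForm`). Truncating `φ` turns formal information into a
holomorphic function `h` with `h ∘ F = λ₁ h + a h^(d+1) + O(‖z‖^(d+2))`, where `d = qk`
(`FormallyConjugate.exists_isSemiconjugacy`).

Fixed curves and uniqueness of `k`: no `λ_j^q` with `j ≥ 2` equals `1`, so the inverse function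
theorem gives a curve `γ` with `F^q(γ(t)) = γ(t) + g(t) e₁`. Iterating the equation for `h` gives
`g(t) = b t^(qk+1) + o(t^(qk+1))` with `b ≠ 0` in the resonant case, whereas `g` vanishes to every
order, hence identically, in the linearizable case (`IsSemiconjugacy.isLittleO_defect`). So `k` is
the order of vanishing of an analytic function, and the same expansion along a given fixed curve
rules out any resonant form.

Basins: on the cone where `|h|` exceeds `|z_j|` for all `j ≥ 2`, the norm of `z` is `O(|h|)`, so the
error is `O(|h|^(d+2))` and one-dimensional parabolic dynamics applies. For a suitable constant, `u
= c^d / h^d` satisfies `u ∘ F = u + 1 + o(1)`, and near `0` the cone is mapped into itself because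
`|λ_j| < 1 = |λ₁|`. The `d` branches of `Re u > R` are petals, and `F` sends the petal of direction
`μ` to that of direction `λ₁ μ` (`IsQuasiParabolic.exists_isPetalFamily`). The orbits of
multiplication by `λ₁` on the `d`-th roots of unity have length `q`, so the petals form `k` cycles,
which are the basins. -/

/-! ### Formal power series: triangularity of substitution and normalisation of one component. -/

section FormalSeries

open MvPowerSeries

variable {n : ℕ}

/-- The monomial `lam ^ e`. -/
noncomputable def multiPow (lam : Fin n → ℂ) (e : Fin n →₀ ℕ) : ℂ := e.prod fun i m => lam i ^ m

/-- The linear part of the formal map `f` is the diagonal matrix with entries `lam`. -/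
def HasDiagonalPart (lam : Fin n → ℂ) (f : Fin n → MvPowerSeries (Fin n) ℂ) : Prop :=
  ∀ j, ((2 : ℕ) : ℕ∞) ≤ (f j - monomial (Finsupp.single j 1) (lam j)).order

lemma natCast_le_order_iff {s : MvPowerSeries (Fin n) ℂ} {N : ℕ} :
    (N : ℕ∞) ≤ s.order ↔ ∀ d : Fin n →₀ ℕ, d.degree < N → coeff d s = 0 :=
  ⟨fun h _ hd => coeff_of_lt_order (lt_of_lt_of_le (by exact_mod_cast hd) h),
    fun h => nat_le_order h⟩

lemma le_order_add {s t : MvPowerSeries (Fin n) ℂ} {N : ℕ∞} (hs : N ≤ s.order)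
    (ht : N ≤ t.order) : N ≤ (s + t).order :=
  (le_min hs ht).trans min_order_le_add

lemma le_order_sub {s t : MvPowerSeries (Fin n) ℂ} {N : ℕ∞} (hs : N ≤ s.order)
    (ht : N ≤ t.order) : N ≤ (s - t).order := by
  rw [sub_eq_add_neg]
  exact le_order_add hs (by rwa [order_neg])

lemma natCast_add_le_order_mul {s t : MvPowerSeries (Fin n) ℂ} {M N : ℕ} (hs : (M : ℕ∞) ≤ s.order)
    (ht : (N : ℕ∞) ≤ t.order) : ((M + N : ℕ) : ℕ∞) ≤ (s * t).order := by
  push_cast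
  exact (add_le_add hs ht).trans le_order_mul

lemma le_order_mul_of_left {s : MvPowerSeries (Fin n) ℂ} (t : MvPowerSeries (Fin n) ℂ) {N : ℕ∞}
    (hs : N ≤ s.order) : N ≤ (s * t).order :=
  (hs.trans le_self_add).trans le_order_mul

lemma degree_le_order_monomial (e : Fin n →₀ ℕ) (c : ℂ) :
    (e.degree : ℕ∞) ≤ (monomial e c : MvPowerSeries (Fin n) ℂ).order := by
  rw [natCast_le_order_iff]
  intro d hd
  rw [coeff_monomial, if_neg]
  rintro rfl
  exact lt_irrefl _ hd

/-- `t` is the leading part of `s` in degree `p`. -/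
def IsLeading (p : ℕ) (s t : MvPowerSeries (Fin n) ℂ) : Prop :=
  (p : ℕ∞) ≤ t.order ∧ ((p + 1 : ℕ) : ℕ∞) ≤ (s - t).order

lemma IsLeading.le_order {p : ℕ} {s t : MvPowerSeries (Fin n) ℂ} (h : IsLeading p s t) :
    (p : ℕ∞) ≤ s.order := by
  have : s = t + (s - t) := by ring
  rw [this]
  exact le_order_add h.1 (le_trans (by exact_mod_cast Nat.le_succ p) h.2)

lemma IsLeading.mul {p r : ℕ} {s t s' t' : MvPowerSeries (Fin n) ℂ} (h : IsLeading p s t)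
    (h' : IsLeading r s' t') : IsLeading (p + r) (s * s') (t * t') := by
  refine ⟨natCast_add_le_order_mul h.1 h'.1, ?_⟩
  have : s * s' - t * t' = (s - t) * s' + t * (s' - t') := by ring
  rw [this]
  refine le_order_add ?_ (by simpa only [add_assoc] using natCast_add_le_order_mul h.1 h'.2)
  have := natCast_add_le_order_mul h.2 h'.le_order
  rwa [show p + 1 + r = p + r + 1 by ring] at this

lemma IsLeading.one : IsLeading 0 (1 : MvPowerSeries (Fin n) ℂ) 1 := by
  simp [IsLeading]

lemma IsLeading.pow {p : ℕ} {s t : MvPowerSeries (Fin n) ℂ} (h : IsLeading p s t) (m : ℕ) :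
    IsLeading (m * p) (s ^ m) (t ^ m) := by
  induction m with
  | zero => simpa using IsLeading.one
  | succ m ih => simpa [pow_succ, Nat.succ_mul] using ih.mul h

/-- Leading parts are multiplicative, and the leading part of `f j` is `lam j` times a variable. -/
lemma HasDiagonalPart.isLeading_prod {lam : Fin n → ℂ} {f : Fin n → MvPowerSeries (Fin n) ℂ}
    (hf : HasDiagonalPart lam f) (e : Fin n →₀ ℕ) :
    IsLeading e.degree (e.prod fun j m => f j ^ m) (monomial e (multiPow lam e)) := by
  have key : IsLeading e.degree (e.prod fun j m => f j ^ m)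
      (e.prod fun j m => (monomial (Finsupp.single j 1) (lam j) : MvPowerSeries (Fin n) ℂ) ^ m) := by
    induction e using Finsupp.induction_linear with
    | zero => simpa using IsLeading.one
    | add a b ha hb =>
      rw [Finsupp.prod_add_index' (by simp) (by simp [pow_add]),
        Finsupp.prod_add_index' (by simp) (by simp [pow_add]), map_add]
      exact ha.mul hb
    | single j m =>
      have h1 : IsLeading 1 (f j) (monomial (Finsupp.single j 1) (lam j)) :=
        ⟨by simpa using degree_le_order_monomial (Finsupp.single j 1) (lam j), hf j⟩
      simpa using h1.pow m
  convert key using 1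
  clear key
  unfold multiPow
  induction e using Finsupp.induction_linear with
  | zero => simp [monomial_zero_one]
  | add a b ha hb =>
    rw [Finsupp.prod_add_index' (by simp) (by simp [pow_add]),
      Finsupp.prod_add_index' (by simp) (by simp [pow_add]), ← ha, ← hb, monomial_mul_monomial]
  | single j m => simp [monomial_pow]

lemma HasDiagonalPart.constantCoeff_eq_zero {lam : Fin n → ℂ}
    {f : Fin n → MvPowerSeries (Fin n) ℂ} (hf : HasDiagonalPart lam f) (j : Fin n) :
    constantCoeff (f j) = 0 := by
  have := natCast_le_order_iff.1 (hf j) 0 (by simp)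
  rw [map_sub, coeff_monomial, if_neg, sub_zero] at this
  · simpa using this
  · intro h
    simpa using congrArg Finsupp.degree h

lemma HasDiagonalPart.hasSubst {lam : Fin n → ℂ} {f : Fin n → MvPowerSeries (Fin n) ℂ}
    (hf : HasDiagonalPart lam f) : HasSubst f :=
  hasSubst_of_constantCoeff_zero hf.constantCoeff_eq_zero

/-- The multi-indices of degree less than `N`. -/
noncomputable def indicesBelow (n N : ℕ) : Finset (Fin n →₀ ℕ) :=
  (Finsupp.finite_of_degree_lt (σ := Fin n) N).toFinset

lemma mem_indicesBelow {N : ℕ} {d : Fin n →₀ ℕ} : d ∈ indicesBelow n N ↔ d.degree < N := by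
  simp [indicesBelow]

/-- A product `f ^ e` with `|e| ≥ |d|` can reach the monomial `d` only through its leading part, so
only `e = d` survives among them. Substitution is thus triangular in the degree, which is what every
recursion below uses. -/
lemma HasDiagonalPart.coeff_subst_eq {lam : Fin n → ℂ} {f : Fin n → MvPowerSeries (Fin n) ℂ}
    (hf : HasDiagonalPart lam f) (D : MvPowerSeries (Fin n) ℂ) (d : Fin n →₀ ℕ) :
    coeff d (subst f D) = multiPow lam d * coeff d D +
      ∑ e ∈ indicesBelow n d.degree, coeff e D * coeff d (e.prod fun j m => f j ^ m) := by
  classical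
  rw [coeff_subst hf.hasSubst]
  have hd : d ∉ indicesBelow n d.degree := by simp [mem_indicesBelow]
  have hlead (e : Fin n →₀ ℕ) (he : d.degree ≤ e.degree) :
      coeff d (e.prod fun j m => f j ^ m) = if d = e then multiPow lam e else 0 := by
    have := natCast_le_order_iff.1 (hf.isLeading_prod e).2 d (Nat.lt_succ_of_le he)
    rw [map_sub, sub_eq_zero] at this
    rw [this, coeff_monomial]
  rw [finsum_eq_sum_of_support_subset (s := insert d (indicesBelow n d.degree)),
    Finset.sum_insert hd]
  · simp only [smul_eq_mul]
    rw [hlead d le_rfl, if_pos rfl, mul_comm]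
  · intro e he
    simp only [Finset.coe_insert, Set.mem_insert_iff, Finset.mem_coe, mem_indicesBelow]
    by_contra! h
    apply he
    simp only [smul_eq_mul]
    rw [hlead e h.2, if_neg (Ne.symm h.1), mul_zero]

/-- Recursion on the degree for the coefficients of a power series. -/
lemma exists_series_of_recursion (step : (d : Fin n →₀ ℕ) → ((Fin n →₀ ℕ) → ℂ) → ℂ)
    (hstep : ∀ d c c', (∀ e : Fin n →₀ ℕ, e.degree < d.degree → c e = c' e) →
      step d c = step d c') :
    ∃ s : MvPowerSeries (Fin n) ℂ, ∀ d, coeff d s = step d fun e => coeff e s := by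
  classical
  let wf := (measure (fun d : Fin n →₀ ℕ => d.degree)).wf
  let c : (Fin n →₀ ℕ) → ℂ := wf.fix fun d rec =>
    step d fun e => if h : e.degree < d.degree then rec e h else 0
  refine ⟨c, fun d => ?_⟩
  change c d = step d fun e => c e
  have : c d = step d fun e => if h : e.degree < d.degree then c e else 0 := wf.fix_eq _ d
  rw [this]
  exact hstep _ _ _ fun e he => by simp [he]

/-- The diagonal entries of the triangular system are `1`, so it is always solvable. This supplies
the components of the conjugate map without constructing an inverse of the change of coordinates. -/
lemma HasDiagonalPart.exists_subst_eq {f : Fin n → MvPowerSeries (Fin n) ℂ}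
    (hf : HasDiagonalPart 1 f) (T : MvPowerSeries (Fin n) ℂ) : ∃ S : MvPowerSeries (Fin n) ℂ, subst f S = T := by
  obtain ⟨S, hS⟩ := exists_series_of_recursion
    (fun d c => coeff d T -
      ∑ e ∈ indicesBelow n d.degree, c e * coeff d (e.prod fun j m => f j ^ m)) (by
    intro d c c' h
    congr 1
    exact Finset.sum_congr rfl fun e he => by rw [h e (mem_indicesBelow.1 he)])
  refine ⟨S, ?_⟩
  ext d
  rw [hf.coeff_subst_eq, hS d]
  simp [multiPow]

/-- By triangularity `S` has no terms below degree `N` either, so the off-diagonal sum vanishes up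
to degree `N`: a change of coordinates tangent to the identity does not alter leading terms. -/
lemma HasDiagonalPart.coeff_eq_of_le_order {f : Fin n → MvPowerSeries (Fin n) ℂ}
    (hf : HasDiagonalPart 1 f) {S : MvPowerSeries (Fin n) ℂ} {N : ℕ}
    (hN : (N : ℕ∞) ≤ (subst f S).order) {d : Fin n →₀ ℕ} (hd : d.degree ≤ N) :
    coeff d S = coeff d (subst f S) := by
  have hlow (M : ℕ) : ∀ d : Fin n →₀ ℕ, d.degree < M → d.degree < N → coeff d S = 0 := by
    induction M with
    | zero => simp
    | succ M ih =>
      intro d hdM hdN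
      have := hf.coeff_subst_eq S d
      rw [natCast_le_order_iff.1 hN d hdN, Finset.sum_eq_zero] at this
      · simpa [multiPow] using this.symm
      · intro e he
        have he := mem_indicesBelow.1 he
        rw [ih e (by omega) (by omega), zero_mul]
  rw [hf.coeff_subst_eq S d, Finset.sum_eq_zero]
  · simp [multiPow]
  · intro e he
    have he := mem_indicesBelow.1 he
    rw [hlow (e.degree + 1) e (by omega) (by omega), zero_mul]

/-- Formal normalisation of one coordinate: `φ ∘ f = lam i • φ` up to resonant monomials. -/
lemma HasDiagonalPart.exists_normalisation {lam : Fin n → ℂ}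
    {f : Fin n → MvPowerSeries (Fin n) ℂ} (hf : HasDiagonalPart lam f) (i : Fin n) :
    ∃ φ : MvPowerSeries (Fin n) ℂ, ((2 : ℕ) : ℕ∞) ≤ (φ - X i).order ∧
      ∀ d : Fin n →₀ ℕ, ¬ IsResonance lam i d → coeff d (subst f φ - lam i • φ) = 0 := by
  classical
  -- In degree at least two the homological equation is divided by `lam i - lam ^ d`. At a resonance
  -- the divisor is zero, and the convention `0⁻¹ = 0` makes the coefficient of `φ` zero there.
  obtain ⟨φ, hφ⟩ := exists_series_of_recursion
    (fun d c => if d.degree < 2 then coeff d (X i : MvPowerSeries (Fin n) ℂ) else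
      (lam i - multiPow lam d)⁻¹ *
      ∑ e ∈ indicesBelow n d.degree, c e * coeff d (e.prod fun j m => f j ^ m)) (by
    intro d c c' h
    congr 2
    exact Finset.sum_congr rfl fun e he => by rw [h e (mem_indicesBelow.1 he)])
  have hlow (d : Fin n →₀ ℕ) (hd : d.degree < 2) :
      coeff d φ = coeff d (X i : MvPowerSeries (Fin n) ℂ) := by rw [hφ d, if_pos hd]
  refine ⟨φ, natCast_le_order_iff.2 fun d hd => by rw [map_sub, hlow d hd, sub_self], ?_⟩
  intro d hd
  rw [map_sub, hf.coeff_subst_eq, coeff_smul]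
  by_cases h2 : d.degree < 2
  · rw [Finset.sum_eq_zero, add_zero, hlow d h2, coeff_X]
    · split_ifs with h
      · subst h
        simp [multiPow]
      · simp
    · intro e he
      have he := mem_indicesBelow.1 he
      have he0 : e = 0 := by
        rw [← Finsupp.degree_eq_zero_iff]
        omega
      rw [hlow e (by omega), he0, coeff_zero_X, zero_mul]
  · have hne : lam i - multiPow lam d ≠ 0 := by
      intro h
      exact hd ⟨by omega, sub_eq_zero.1 h⟩
    have := hφ d
    rw [if_neg h2, eq_inv_mul_iff_mul_eq₀ hne] at this
    rw [← this]
    ring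

lemma IsFormalDiff.of_hasDiagonalPart_one {Φ : Fin n → MvPowerSeries (Fin n) ℂ}
    (hΦ : HasDiagonalPart 1 Φ) : IsFormalDiff Φ := by
  refine ⟨hΦ.constantCoeff_eq_zero, ?_⟩
  convert isUnit_one
  ext i j
  have := natCast_le_order_iff.1 (hΦ i) (Finsupp.single j 1) (by simp)
  rw [map_sub, sub_eq_zero, coeff_monomial] at this
  rw [Matrix.of_apply, this, Matrix.one_apply]
  by_cases h : i = j
  · simp [h]
  · rw [if_neg h, if_neg]
    intro h'
    rw [Finsupp.single_left_inj one_ne_zero] at h'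
    exact h h'.symm

/-- The lowest term of the remainder `b` of the normalised coordinate decides between the two cases.
The other components of the conjugate map are unconstrained, so the other coordinates are left
alone. -/
theorem formallyLinearizable_or_hasResonantForm [NeZero n] {F : (Fin n → ℂ) → (Fin n → ℂ)}
    {lam : Fin n → ℂ} {f : Fin n → MvPowerSeries (Fin n) ℂ} (hFf : HasTaylorSeries F f)
    (hf : HasDiagonalPart lam f) {α : Fin n →₀ ℕ} (hα : IsOneResonant lam 1 α) :
    FormallyLinearizable F lam 1 ∨ ∃ k, HasResonantForm F lam 1 α k := by
  classical
  obtain ⟨hα0, -, hres⟩ := hα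
  have hzero (j : Fin n) (hj : j.val < 1) : j = 0 := by
    ext
    simpa using hj
  have hres0 := hres 0 (by simp)
  have hαdeg : 0 < α.degree := by
    rw [Nat.pos_iff_ne_zero]
    exact fun h => hα0 ((Finsupp.degree_eq_zero_iff α).1 h)
  obtain ⟨φ, hφ, hφres⟩ := hf.exists_normalisation 0
  set b := subst f φ - lam 0 • φ with hb
  let Φ : Fin n → MvPowerSeries (Fin n) ℂ := Function.update X 0 φ
  have hΦ0 : Φ 0 = φ := by simp [Φ]
  have hΦ : HasDiagonalPart 1 Φ := by
    intro j
    by_cases hj : j = 0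
    · subst hj
      rw [hΦ0]
      exact hφ
    · simp only [Φ, Function.update_of_ne hj, X, Pi.one_apply]
      simp
  have hlin : subst Φ (monomial (Finsupp.single 0 1) (lam 0) : MvPowerSeries (Fin n) ℂ) =
      lam 0 • φ := by
    rw [subst_monomial hΦ.hasSubst]
    simp [hΦ0, Algebra.smul_def]
  choose S hS using fun T => hΦ.exists_subst_eq T
  by_cases hb0 : b = 0
  · left
    refine ⟨fun j => if j = 0 then monomial (Finsupp.single 0 1) (lam 0) else S (subst f (Φ j)),
      ⟨f, Φ, hFf, .of_hasDiagonalPart_one hΦ, fun j => ?_⟩, fun j hj => ?_⟩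
    · beta_reduce
      split_ifs with h
      · rw [hlin, h, hΦ0]
        exact sub_eq_zero.1 hb0
      · rw [hS]
    · beta_reduce
      rw [hzero j hj, if_pos rfl]
  · right
    obtain ⟨d, hd, hdb⟩ := exists_coeff_ne_zero_and_order (ne_zero_iff_order_finite.1 hb0)
    obtain ⟨k, hk, hdk⟩ := (hres0 d).1 (by_contra fun h => hd (hφres d h))
    have hdeg : d.degree = α.degree * k + 1 := by
      rw [hdk]
      simp [mul_comm]
    refine ⟨k, hk, fun j => if j = 0 then monomial (Finsupp.single 0 1) (lam 0) + S b
      else S (subst f (Φ j)), ⟨f, Φ, hFf, .of_hasDiagonalPart_one hΦ, fun j => ?_⟩,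
      fun _ => coeff d b, ⟨0, by simp, hd⟩, fun j hj e he => ?_⟩
    · beta_reduce
      split_ifs with h
      · rw [subst_add hΦ.hasSubst, hlin, hS, h, hΦ0, hb]
        ring
      · rw [hS]
    · beta_reduce
      rw [hzero j hj, if_pos rfl, map_add, map_add]
      congr 1
      rw [hΦ.coeff_eq_of_le_order (N := d.degree) (by rw [hS, ← hdb]) (by omega), hS, ← hdk,
        coeff_monomial]
      split_ifs with hed
      · rw [hed]
      -- Resonances of the same degree coincide, since `s • α + e₁` has degree `|α| s + 1` and `|α|
      -- > 0`; hence the leading part of `b` is a single monomial.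
      · by_contra hne
        obtain ⟨k', hk', hek⟩ := (hres0 e).1 (by_contra fun h => hne (hφres e h))
        have h1 : d.degree ≤ e.degree := by
          have := order_le hne
          rw [← hdb] at this
          exact_mod_cast this
        have h2 : α.degree * k' + 1 = α.degree * k + 1 := by
          have : e.degree = α.degree * k' + 1 := by
            rw [hek]
            simp [mul_comm]
          omega
        have h3 : k' = k := Nat.eq_of_mul_eq_mul_left hαdeg (by omega)
        exact hed (by rw [hek, hdk, h3])

end FormalSeries

/-! ### Expansion of holomorphic functions in multivariate power series. -/

section TaylorSeries

variable {n : ℕ}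

lemma norm_multiPow_le (z : Fin n → ℂ) (d : Fin n →₀ ℕ) : ‖multiPow z d‖ ≤ ‖z‖ ^ d.degree := by
  rw [multiPow, Finsupp.prod_fintype _ _ (by simp), norm_prod, Finsupp.degree_eq_sum,
    ← Finset.prod_pow_eq_pow_sum]
  exact Finset.prod_le_prod (fun _ _ => norm_nonneg _) fun i _ => by
    rw [norm_pow]
    gcongr
    exact norm_le_pi_norm z i

/-- The multi-index counting the values of a finite word. -/
noncomputable def wordIndex (x : Σ m : ℕ, Fin m → Fin n) : Fin n →₀ ℕ :=
  ∑ l, Finsupp.single (x.2 l) 1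

lemma degree_wordIndex (x : Σ m : ℕ, Fin m → Fin n) : (wordIndex x).degree = x.1 := by
  simp [wordIndex]

lemma multiPow_wordIndex (z : Fin n → ℂ) (x : Σ m : ℕ, Fin m → Fin n) :
    multiPow z (wordIndex x) = ∏ l, z (x.2 l) := by
  rw [multiPow, wordIndex, ← Finsupp.prod_finsetSum_index (by simp) (by simp [pow_add])]
  simp

lemma finite_wordIndex_fiber (d : Fin n →₀ ℕ) :
    Finite {x : Σ m : ℕ, Fin m → Fin n // wordIndex x = d} := by
  refine Set.Finite.subset (Set.finite_range fun i : Fin d.degree → Fin n =>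
    (⟨d.degree, i⟩ : Σ m : ℕ, Fin m → Fin n)) ?_
  rintro ⟨m, i⟩ (hx : wordIndex _ = d)
  have : m = d.degree := by rw [← hx, degree_wordIndex]
  subst this
  exact ⟨i, rfl⟩

/-- A holomorphic function of several variables is the sum of a multivariate power series. -/
lemma AnalyticAt.exists_hasSum_multiPow {H : (Fin n → ℂ) → ℂ} (hH : AnalyticAt ℂ H 0) :
    ∃ s : MvPowerSeries (Fin n) ℂ, ∀ᶠ z in 𝓝 (0 : Fin n → ℂ),
      HasSum (fun d => MvPowerSeries.coeff d s * multiPow z d) (H z) := by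
  obtain ⟨p, r, hp⟩ := hH
  -- Expanding the multilinear terms on basis vectors gives a sum over words; the coefficient of a
  -- monomial collects the finitely many words with that multi-index.
  let c : (Σ m : ℕ, Fin m → Fin n) → ℂ := fun x => p x.1 fun l => Pi.single (x.2 l) 1
  have hc (x) : ‖c x‖ ≤ ‖p x.1‖ := by
    refine ((p x.1).le_opNorm _).trans ?_
    refine mul_le_of_le_one_right (norm_nonneg _) (Finset.prod_le_one (fun _ _ => norm_nonneg _) ?_)
    intro l _
    exact (Pi.norm_single _).trans_le (by simp)
  let s : MvPowerSeries (Fin n) ℂ := fun d => ∑' x : {x // wordIndex x = d}, c x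
  refine ⟨s, ?_⟩
  obtain ⟨r', hr'0, hr'⟩ := ENNReal.lt_iff_exists_nnreal_btwn.1 hp.r_pos
  have hr'0 : 0 < r' := by exact_mod_cast hr'0
  have hsum := p.summable_norm_mul_pow (hr'.trans_le hp.r_le)
  -- There are `n ^ m` words of length `m`, so the sum over words is dominated by `∑ ‖p m‖ (n ‖z‖) ^
  -- m`.
  have hball : ∀ᶠ z in 𝓝 (0 : Fin n → ℂ), (n : ℝ) * ‖z‖ < r' ∧ z ∈ Metric.eball 0 r := by
    refine Eventually.and ?_ (Metric.eball_mem_nhds _ hp.r_pos)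
    have : Tendsto (fun z : Fin n → ℂ => (n : ℝ) * ‖z‖) (𝓝 0) (𝓝 ((n : ℝ) * ‖(0 : Fin n → ℂ)‖)) :=
      (continuous_const.mul continuous_norm).tendsto _
    exact this.eventually_lt_const (by simpa using hr'0)
  filter_upwards [hball] with z ⟨hz, hzr⟩
  let t : (Σ m : ℕ, Fin m → Fin n) → ℂ := fun x => c x * multiPow z (wordIndex x)
  have ht (x) : ‖t x‖ ≤ ‖p x.1‖ * ‖z‖ ^ x.1 := by
    rw [norm_mul]
    gcongr
    · exact hc x
    · simpa [degree_wordIndex] using norm_multiPow_le z (wordIndex x)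
  have htsum : Summable t := by
    refine Summable.of_norm ((summable_sigma_of_nonneg fun _ => norm_nonneg _).2
      ⟨fun m => Summable.of_finite, ?_⟩)
    refine Summable.of_nonneg_of_le (fun m => tsum_nonneg fun _ => norm_nonneg _) (fun m => ?_) hsum
    rw [tsum_fintype]
    refine (Finset.sum_le_sum fun i _ => ht ⟨m, i⟩).trans ?_
    change ∑ _i : Fin m → Fin n, ‖p m‖ * ‖z‖ ^ m ≤ _
    rw [Finset.sum_const, Finset.card_univ, Fintype.card_fun, Fintype.card_fin, Fintype.card_fin,
      nsmul_eq_mul]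
    push_cast
    rw [mul_left_comm, ← mul_pow]
    gcongr
  have hH : HasSum t (H z) := by
    have h1 := hp.hasSum hzr
    rw [zero_add] at h1
    refine HasSum.sigma_of_hasSum h1 (fun m => ?_) htsum
    have h2 : p m (fun _ => z) = ∑ i : Fin m → Fin n, t ⟨m, i⟩ := by
      have hz : z = ∑ i, z i • (Pi.single i 1 : Fin n → ℂ) := by
        ext j
        simp [Finset.sum_apply, Pi.single_apply]
      conv_lhs => rw [hz]
      rw [(p m).map_sum (fun (_ : Fin m) (i : Fin n) => z i • (Pi.single i 1 : Fin n → ℂ))]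
      refine Finset.sum_congr rfl fun i _ => ?_
      rw [(p m).map_smul_univ]
      simp only [t, c, multiPow_wordIndex, smul_eq_mul]
      rw [mul_comm]
    rw [h2]
    exact hasSum_fintype _
  have h3 := (Equiv.sigmaFiberEquiv (wordIndex (n := n))).hasSum_iff.2 hH
  refine h3.sigma fun d => ?_
  have := finite_wordIndex_fiber d
  have h4 : HasSum (fun x : {x // wordIndex x = d} => c x)
      (MvPowerSeries.coeff d s) := Summable.of_finite.hasSum
  have h5 : (fun x : {x // wordIndex x = d} => c x * multiPow z d) =
      fun x => (t ∘ Equiv.sigmaFiberEquiv (wordIndex (n := n))) ⟨d, x⟩ := by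
    ext x
    change _ = c x * multiPow z (wordIndex x.1)
    rw [x.2]
  rw [← h5]
  exact h4.mul_right _

lemma exists_hasTaylorSeries {F : (Fin n → ℂ) → (Fin n → ℂ)} (hF : AnalyticAt ℂ F 0) :
    ∃ f, HasTaylorSeries F f := by
  have h (j : Fin n) : AnalyticAt ℂ (fun z => F z j) 0 :=
    analyticAt_pi_iff.1 hF j
  choose f hf using fun j => (h j).exists_hasSum_multiPow
  exact ⟨f, eventually_all.2 hf⟩

end TaylorSeries

/-! ### From formal conjugacy to holomorphic semiconjugacy up to a finite order. -/

section Jets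

open Asymptotics

variable {n : ℕ}

lemma eval_eq_sum_multiPow (P : MvPolynomial (Fin n) ℂ) (z : Fin n → ℂ) :
    MvPolynomial.eval z P = ∑ d ∈ P.support, P.coeff d * multiPow z d := by
  rw [MvPolynomial.eval_eq]
  refine Finset.sum_congr rfl fun d _ => ?_
  rw [multiPow, Finsupp.prod]

/-- The function `H` agrees with the power series `s` at `0` up to an error `O(‖z‖ ^ N)`. -/
def IsJet (N : ℕ) (H : (Fin n → ℂ) → ℂ) (s : MvPowerSeries (Fin n) ℂ) : Prop :=
  ∃ P : MvPolynomial (Fin n) ℂ, (N : ℕ∞) ≤ (s - P).order ∧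
    (fun z => H z - MvPolynomial.eval z P) =O[𝓝 0] fun z => ‖z‖ ^ N

lemma isBigO_eval_of_le_order {P : MvPolynomial (Fin n) ℂ} {N : ℕ}
    (hP : (N : ℕ∞) ≤ (P : MvPowerSeries (Fin n) ℂ).order) :
    (fun z => MvPolynomial.eval z P) =O[𝓝 0] fun z : Fin n → ℂ => ‖z‖ ^ N := by
  simp only [eval_eq_sum_multiPow]
  refine IsBigO.fun_sum fun d hd => ?_
  have hdN : N ≤ d.degree := by
    by_contra! h
    have := natCast_le_order_iff.1 hP d h
    rw [MvPolynomial.coeff_coe] at this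
    exact (MvPolynomial.mem_support_iff.1 hd) this
  refine IsBigO.of_bound ‖P.coeff d‖ ?_
  filter_upwards [Metric.ball_mem_nhds (0 : Fin n → ℂ) one_pos] with z hz
  rw [norm_mul, norm_pow, norm_norm]
  gcongr
  refine (norm_multiPow_le z d).trans (pow_le_pow_of_le_one (norm_nonneg _) ?_ hdN)
  exact (mem_ball_zero_iff.1 hz).le

lemma isBigO_eval_one (P : MvPolynomial (Fin n) ℂ) :
    (fun z => MvPolynomial.eval z P) =O[𝓝 0] fun _ : Fin n → ℂ => (1 : ℝ) :=
  (MvPolynomial.continuous_eval P).continuousAt.isBigO_one ℝ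

lemma isBigO_pow_norm_one (N : ℕ) :
    (fun z : Fin n → ℂ => ‖z‖ ^ N) =O[𝓝 0] fun _ : Fin n → ℂ => (1 : ℝ) :=
  (continuous_norm.pow N).continuousAt.isBigO_one ℝ

lemma isJet_eval (N : ℕ) (P : MvPolynomial (Fin n) ℂ) :
    IsJet N (fun z => MvPolynomial.eval z P) P :=
  ⟨P, by simp, by simpa using isBigO_zero _ _⟩

/-- Two polynomials agreeing with `s` below degree `N` differ by `O(‖z‖ ^ N)`, so the choice of
polynomial in `IsJet` is immaterial. -/
lemma IsJet.isBigO_sub {N : ℕ} {H : (Fin n → ℂ) → ℂ} {s : MvPowerSeries (Fin n) ℂ}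
    (h : IsJet N H s) {P : MvPolynomial (Fin n) ℂ} (hP : (N : ℕ∞) ≤ (s - P).order) :
    (fun z => H z - MvPolynomial.eval z P) =O[𝓝 0] fun z => ‖z‖ ^ N := by
  obtain ⟨Q, hQ, hH⟩ := h
  have : (N : ℕ∞) ≤ ((Q - P : MvPolynomial (Fin n) ℂ) : MvPowerSeries (Fin n) ℂ).order := by
    rw [show ((Q - P : MvPolynomial (Fin n) ℂ) : MvPowerSeries (Fin n) ℂ) = Q - P from
      map_sub MvPolynomial.coeToMvPowerSeries.ringHom Q P, ← sub_sub_sub_cancel_left _ _ s]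
    exact le_order_sub hP hQ
  refine (hH.add (isBigO_eval_of_le_order this)).congr_left fun z => ?_
  rw [map_sub]
  ring

lemma IsJet.add {N : ℕ} {H K : (Fin n → ℂ) → ℂ} {s t : MvPowerSeries (Fin n) ℂ}
    (hH : IsJet N H s) (hK : IsJet N K t) : IsJet N (fun z => H z + K z) (s + t) := by
  obtain ⟨P, hP, hHP⟩ := hH
  obtain ⟨Q, hQ, hKQ⟩ := hK
  refine ⟨P + Q, ?_, ?_⟩
  · rw [MvPolynomial.coe_add, add_sub_add_comm]
    exact le_order_add hP hQ
  · refine (hHP.add hKQ).congr_left fun z => ?_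
    rw [map_add]
    ring

lemma IsJet.isBigO_one {N : ℕ} {H : (Fin n → ℂ) → ℂ} {s : MvPowerSeries (Fin n) ℂ}
    (hH : IsJet N H s) : H =O[𝓝 0] fun _ => (1 : ℝ) := by
  obtain ⟨P, hP, hHP⟩ := hH
  refine ((hHP.trans (isBigO_pow_norm_one N)).add (isBigO_eval_one P)).congr_left fun z => ?_
  ring

lemma IsJet.mul {N : ℕ} {H K : (Fin n → ℂ) → ℂ} {s t : MvPowerSeries (Fin n) ℂ}
    (hH : IsJet N H s) (hK : IsJet N K t) : IsJet N (fun z => H z * K z) (s * t) := by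
  have hH1 := hH.isBigO_one
  obtain ⟨P, hP, hHP⟩ := hH
  obtain ⟨Q, hQ, hKQ⟩ := hK
  refine ⟨P * Q, ?_, ?_⟩
  · rw [MvPolynomial.coe_mul, show s * t - P * Q = (t - Q) * s + (s - P) * Q by ring]
    exact le_order_add (le_order_mul_of_left _ hQ) (le_order_mul_of_left _ hP)
  · have h1 := hH1.mul hKQ
    have h2 := hHP.mul (isBigO_eval_one Q)
    simp only [one_mul] at h1
    simp only [mul_one] at h2
    refine (h1.add h2).congr_left fun z => ?_
    rw [map_mul]
    ring

lemma IsJet.eval_comp {N : ℕ} {F : (Fin n → ℂ) → (Fin n → ℂ)}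
    {f : Fin n → MvPowerSeries (Fin n) ℂ} (hF : ∀ j, IsJet N (fun z => F z j) (f j))
    (P : MvPolynomial (Fin n) ℂ) :
    IsJet N (fun z => MvPolynomial.eval (F z) P) (MvPolynomial.aeval f P) := by
  induction P using MvPolynomial.induction_on with
  | C a => simpa [MvPowerSeries.algebraMap_apply] using isJet_eval N (MvPolynomial.C a)
  | add p q hp hq => simpa using hp.add hq
  | mul_X p i hp => simpa using hp.mul (hF i)

lemma isJet_of_eventually_hasSum {H : (Fin n → ℂ) → ℂ} {s : MvPowerSeries (Fin n) ℂ}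
    (hs : ∀ᶠ z in 𝓝 (0 : Fin n → ℂ),
      HasSum (fun d => MvPowerSeries.coeff d s * multiPow z d) (H z)) (N : ℕ) :
    IsJet N H s := by
  classical
  have hsP : (N : ℕ∞) ≤ (s - (MvPowerSeries.truncTotal N s : MvPolynomial (Fin n) ℂ)).order := by
    refine natCast_le_order_iff.2 fun d hd => ?_
    rw [map_sub, MvPolynomial.coeff_coe, MvPowerSeries.coeff_truncTotal s hd, sub_self]
  refine ⟨MvPowerSeries.truncTotal N s, hsP, ?_⟩
  set P := MvPowerSeries.truncTotal N s
  obtain ⟨ε, hε, hball⟩ := Metric.eventually_nhds_iff.1 hs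
  set r : ℝ := ε / 2 with hr
  have hr0 : 0 < r := by positivity
  -- Absolute convergence at the point with all coordinates `r` dominates the tail on the ball of
  -- radius `r`.
  have hsum : Summable fun d => ‖MvPowerSeries.coeff d s‖ * r ^ d.degree := by
    have h := (hball (y := fun _ => (r : ℂ)) (by
      rw [dist_zero_right]
      refine (pi_norm_const_le _).trans_lt ?_
      rw [Complex.norm_real, Real.norm_of_nonneg hr0.le]
      linarith)).summable.norm
    refine h.congr fun d => ?_
    rw [norm_mul, multiPow, Finsupp.prod_fintype _ _ (by simp), norm_prod, Finsupp.degree_eq_sum,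
      ← Finset.prod_pow_eq_pow_sum]
    simp [abs_of_pos hr0]
  refine IsBigO.of_bound (∑' d, ‖MvPowerSeries.coeff d s‖ * r ^ d.degree / r ^ N) ?_
  filter_upwards [Metric.ball_mem_nhds (0 : Fin n → ℂ) hr0] with z hz
  rw [mem_ball_zero_iff] at hz
  have h1 := hball (y := z) (by rw [dist_zero_right]; linarith)
  have h2 : HasSum (fun d => P.coeff d * multiPow z d) (MvPolynomial.eval z P) := by
    rw [eval_eq_sum_multiPow]
    refine hasSum_sum_of_ne_finset_zero fun d hd => ?_
    rw [MvPolynomial.notMem_support_iff.1 hd, zero_mul]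
  rw [norm_pow, norm_norm]
  refine (h1.sub h2).norm_le_of_bounded ((hsum.div_const _).hasSum.mul_right _) fun d => ?_
  rw [← sub_mul, norm_mul]
  by_cases hd : d.degree < N
  · rw [show P.coeff d = MvPowerSeries.coeff d s from MvPowerSeries.coeff_truncTotal s hd,
      sub_self, norm_zero, zero_mul]
    positivity
  · push Not at hd
    rw [show P.coeff d = 0 from MvPowerSeries.coeff_truncTotal_eq_zero s hd, sub_zero,
      mul_div_assoc, mul_assoc]
    gcongr
    refine (norm_multiPow_le z d).trans ?_
    obtain ⟨m, hm⟩ := Nat.exists_eq_add_of_le hd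
    rw [hm, pow_add, pow_add, mul_div_cancel_left₀ _ (by positivity), mul_comm]
    gcongr

lemma HasTaylorSeries.isJet {F : (Fin n → ℂ) → (Fin n → ℂ)}
    {f : Fin n → MvPowerSeries (Fin n) ℂ} (h : HasTaylorSeries F f) (N : ℕ) (j : Fin n) :
    IsJet N (fun z => F z j) (f j) :=
  isJet_of_eventually_hasSum (h.mono fun _ hz => hz j) N

lemma exists_eq_single_of_degree_eq_one {d : Fin n →₀ ℕ} (hd : d.degree = 1) :
    ∃ i, d = Finsupp.single i 1 := by
  have h0 : d ≠ 0 := by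
    rintro rfl
    simp at hd
  obtain ⟨i, hi⟩ := Finsupp.ne_iff.1 h0
  refine ⟨i, ?_⟩
  have hle : Finsupp.single i 1 ≤ d := by
    rw [Finsupp.single_le_iff]
    simp only [Finsupp.coe_zero, Pi.zero_apply] at hi
    omega
  obtain ⟨e, rfl⟩ := exists_add_of_le hle
  rw [map_add, Finsupp.degree_single] at hd
  rw [(Finsupp.degree_eq_zero_iff e).1 (by omega), add_zero]

/-- The differential at `0` determined by the linear coefficients of a power series. -/
noncomputable def linearPart (s : MvPowerSeries (Fin n) ℂ) : (Fin n → ℂ) →L[ℂ] ℂ :=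
  ∑ i, MvPowerSeries.coeff (Finsupp.single i 1) s •
    (ContinuousLinearMap.proj i : (Fin n → ℂ) →L[ℂ] ℂ)

lemma linearPart_apply (s : MvPowerSeries (Fin n) ℂ) (v : Fin n → ℂ) :
    linearPart s v = ∑ i, MvPowerSeries.coeff (Finsupp.single i 1) s * v i := by
  simp [linearPart]

lemma IsJet.eq_and_hasFDerivAt {H : (Fin n → ℂ) → ℂ} {s : MvPowerSeries (Fin n) ℂ}
    (h : IsJet 2 H s) :
    H 0 = MvPowerSeries.constantCoeff s ∧ HasFDerivAt H (linearPart s) 0 := by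
  classical
  let P : MvPolynomial (Fin n) ℂ := MvPolynomial.C (MvPowerSeries.constantCoeff s) +
    ∑ i, MvPolynomial.C (MvPowerSeries.coeff (Finsupp.single i 1) s) * MvPolynomial.X i
  have hP : ((2 : ℕ) : ℕ∞) ≤ (s - P).order := by
    refine natCast_le_order_iff.2 fun d hd => ?_
    rw [map_sub, MvPolynomial.coeff_coe, sub_eq_zero]
    obtain hd | hd : d.degree = 0 ∨ d.degree = 1 := by omega
    · rw [(Finsupp.degree_eq_zero_iff d).1 hd]
      simp [P, MvPolynomial.coeff_sum, MvPolynomial.coeff_C_mul]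
    · obtain ⟨i, rfl⟩ := exists_eq_single_of_degree_eq_one hd
      have h0 : (0 : Fin n →₀ ℕ) ≠ Finsupp.single i 1 := by
        intro h
        simpa using congrArg Finsupp.degree h
      simp [P, MvPolynomial.coeff_sum, MvPolynomial.coeff_C_mul, MvPolynomial.coeff_C,
        MvPolynomial.coeff_X, h0, Finsupp.single_left_inj]
  have hev (z : Fin n → ℂ) :
      MvPolynomial.eval z P = MvPowerSeries.constantCoeff s + linearPart s z := by
    simp [P, linearPart_apply]
  have hO := h.isBigO_sub hP
  have hO' : (fun z => H z - MvPolynomial.eval z P) =O[𝓝 0] fun z => ‖z - 0‖ ^ 2 := by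
    simpa only [sub_zero] using hO
  refine ⟨?_, ?_⟩
  · have := hO'.eq_zero_of_norm_pow two_ne_zero
    rw [hev, map_zero, add_zero, sub_eq_zero] at this
    exact this
  · have h1 := hO'.hasFDerivAt (𝕜 := ℂ) one_lt_two
    have h2 : HasFDerivAt (fun z => MvPolynomial.eval z P) (linearPart s) 0 := by
      simp only [hev]
      exact (linearPart s).hasFDerivAt.const_add _
    simpa using h1.fun_add h2

lemma HasTaylorSeries.hasDiagonalPart {F : (Fin n → ℂ) → (Fin n → ℂ)}
    {f : Fin n → MvPowerSeries (Fin n) ℂ} (h : HasTaylorSeries F f) (hF0 : F 0 = 0)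
    (hF : DifferentiableAt ℂ F 0) {lam : Fin n → ℂ}
    (hdiag : ∀ v j, fderiv ℂ F 0 v j = lam j * v j) : HasDiagonalPart lam f := by
  classical
  intro j
  obtain ⟨h1, h2⟩ := (h.isJet 2 j).eq_and_hasFDerivAt
  have h3 := (hasFDerivAt_pi'.1 hF.hasFDerivAt j).unique h2
  refine natCast_le_order_iff.2 fun d hd => ?_
  rw [map_sub, sub_eq_zero, MvPowerSeries.coeff_monomial]
  obtain hd | hd : d.degree = 0 ∨ d.degree = 1 := by omega
  · rw [(Finsupp.degree_eq_zero_iff d).1 hd, if_neg]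
    · simpa [hF0] using h1.symm
    · intro h
      simpa using congrArg Finsupp.degree h
  · obtain ⟨i, rfl⟩ := exists_eq_single_of_degree_eq_one hd
    have h4 := DFunLike.congr_fun h3 (Pi.single i 1)
    rw [linearPart_apply] at h4
    simp only [ContinuousLinearMap.comp_apply, ContinuousLinearMap.proj_apply, hdiag] at h4
    simp only [Pi.single_apply, mul_ite, mul_one, mul_zero, Finset.sum_ite_eq',
      Finset.mem_univ, if_true] at h4
    rw [← h4]
    simp [Finsupp.single_left_inj, eq_comm]

lemma natCast_le_order_subst {f : Fin n → MvPowerSeries (Fin n) ℂ}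
    (hf : ∀ j, MvPowerSeries.constantCoeff (f j) = 0) {s : MvPowerSeries (Fin n) ℂ} {N : ℕ∞}
    (hs : N ≤ s.order) : N ≤ (MvPowerSeries.subst f s).order := by
  refine le_trans ?_
    (MvPowerSeries.le_order_subst (MvPowerSeries.hasSubst_of_constantCoeff_zero hf) s)
  calc N = 1 * N := (one_mul N).symm
    _ ≤ _ := mul_le_mul' (le_iInf fun i =>
      MvPowerSeries.one_le_order_iff_constCoeff_eq_zero.2 (hf i)) hs

/-- `h` is a holomorphic coordinate function which `F` multiplies by `μ + a * h ^ (m - 1)`, up to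
an error of order `N` at `0`. -/
structure IsSemiconjugacy (F : (Fin n → ℂ) → (Fin n → ℂ)) (μ a : ℂ) (m N : ℕ)
    (h : (Fin n → ℂ) → ℂ) : Prop where
  analyticAt : AnalyticAt ℂ h 0
  map_zero : h 0 = 0
  fderiv_ne_zero : fderiv ℂ h 0 ≠ 0
  isBigO : (fun z => h (F z) - (μ * h z + a * h z ^ m)) =O[𝓝 0] fun z => ‖z‖ ^ N

/-- The series `Φ j` may diverge, but its truncation in degree `N` is a polynomial satisfying the
same functional equation up to order `N`. -/
lemma FormallyConjugate.exists_isSemiconjugacy {F : (Fin n → ℂ) → (Fin n → ℂ)} (hF0 : F 0 = 0)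
    {G : Fin n → MvPowerSeries (Fin n) ℂ} (hG : FormallyConjugate F G) {μ a : ℂ} {m N : ℕ}
    (hN : 2 ≤ N) {j : Fin n}
    (hGj : (N : ℕ∞) ≤ (G j - (MvPowerSeries.monomial (Finsupp.single j 1) μ +
      MvPowerSeries.monomial (Finsupp.single j m) a)).order) :
    ∃ h, IsSemiconjugacy F μ a m N h := by
  classical
  obtain ⟨f, Φ, hf, ⟨hΦ0, hΦ1⟩, hconj⟩ := hG
  have hf0 (i : Fin n) : MvPowerSeries.constantCoeff (f i) = 0 := by
    rw [← (hf.isJet 2 i).eq_and_hasFDerivAt.1, hF0, Pi.zero_apply]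
  have hfs := MvPowerSeries.hasSubst_of_constantCoeff_zero hf0
  have hΦs := MvPowerSeries.hasSubst_of_constantCoeff_zero hΦ0
  set P : MvPolynomial (Fin n) ℂ := MvPowerSeries.truncTotal N (Φ j)
  have hP (d : Fin n →₀ ℕ) (hd : d.degree < N) : P.coeff d = MvPowerSeries.coeff d (Φ j) :=
    MvPowerSeries.coeff_truncTotal _ hd
  have hΦP : (N : ℕ∞) ≤ (Φ j - P).order := natCast_le_order_iff.2 fun d hd => by
    rw [map_sub, MvPolynomial.coeff_coe, hP d hd, sub_self]
  have hjet : IsJet 2 (fun z => MvPolynomial.eval z P) (P : MvPowerSeries (Fin n) ℂ) :=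
    isJet_eval 2 P
  refine ⟨fun z => MvPolynomial.eval z P, ?_, ?_, ?_, ?_⟩
  · exact AnalyticOnNhd.eval_mvPolynomial P 0 (mem_univ _)
  · rw [hjet.eq_and_hasFDerivAt.1, ← MvPowerSeries.coeff_zero_eq_constantCoeff_apply,
      MvPolynomial.coeff_coe, hP 0 (by simp; omega), MvPowerSeries.coeff_zero_eq_constantCoeff_apply,
      hΦ0]
  · rw [hjet.eq_and_hasFDerivAt.2.fderiv]
    intro h0
    -- A vanishing differential would give the invertible linear part of `Φ` a zero row.
    have hrow (i : Fin n) : MvPowerSeries.coeff (Finsupp.single i 1) (Φ j) = 0 := by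
      have := DFunLike.congr_fun h0 (Pi.single i 1)
      rw [linearPart_apply] at this
      simp only [Pi.single_apply, mul_ite, mul_one, mul_zero, Finset.sum_ite_eq',
        Finset.mem_univ, if_true, _root_.zero_apply, MvPolynomial.coeff_coe] at this
      rw [← this, hP _ (by simp; omega)]
    have hdet := (Matrix.isUnit_iff_isUnit_det _).1 hΦ1
    rw [Matrix.det_eq_zero_of_row_eq_zero j fun i => by rw [Matrix.of_apply, hrow i]] at hdet
    exact not_isUnit_zero hdet
  · have h1 : IsJet N (fun z => MvPolynomial.eval (F z) P) (MvPolynomial.aeval f P) :=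
      IsJet.eval_comp (hf.isJet N) P
    set Q : MvPolynomial (Fin n) ℂ := MvPolynomial.C μ * P + MvPolynomial.C a * P ^ m
    have hQ (z : Fin n → ℂ) : MvPolynomial.eval z Q =
        μ * MvPolynomial.eval z P + a * MvPolynomial.eval z P ^ m := by simp [Q]
    simp only [← hQ]
    refine h1.isBigO_sub ?_
    rw [← MvPowerSeries.subst_coe]
    have e1 := natCast_le_order_subst hf0 hΦP
    have e2 := natCast_le_order_subst hΦ0 hGj
    rw [MvPowerSeries.subst_sub hfs, hconj j] at e1
    rw [MvPowerSeries.subst_sub hΦs, MvPowerSeries.subst_add hΦs, MvPowerSeries.subst_monomial hΦs,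
      MvPowerSeries.subst_monomial hΦs, Finsupp.prod_single_index (by simp),
      Finsupp.prod_single_index (by simp), pow_one] at e2
    obtain ⟨c, hc⟩ := sub_dvd_pow_sub_pow (Φ j) (P : MvPowerSeries (Fin n) ℂ) m
    have hQ' : (Q : MvPowerSeries (Fin n) ℂ) =
        algebraMap ℂ _ μ * P + algebraMap ℂ _ a * (P : MvPowerSeries (Fin n) ℂ) ^ m := by
      simp [Q, MvPowerSeries.algebraMap_apply]
    -- Three errors of order `N`: the remainder of `G j` composed with `Φ`, the tail of `Φ j`
    -- composed with `f`, and the replacement of `Φ j` by `P` in `μ x + a x ^ m`.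
    have e3 : MvPowerSeries.subst f (P : MvPowerSeries (Fin n) ℂ) - Q =
        (MvPowerSeries.subst Φ (G j) - (algebraMap ℂ _ μ * Φ j + algebraMap ℂ _ a * Φ j ^ m))
        - (MvPowerSeries.subst Φ (G j) - MvPowerSeries.subst f (P : MvPowerSeries (Fin n) ℂ))
        + (Φ j - P) * (algebraMap ℂ _ μ + algebraMap ℂ _ a * c) := by
      rw [hQ']
      linear_combination (algebraMap ℂ (MvPowerSeries (Fin n) ℂ) a) * hc
    rw [e3]
    exact le_order_add (le_order_sub e2 e1) (le_order_mul_of_left _ hΦP)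

lemma HasResonantForm.exists_isSemiconjugacy [NeZero n] {F : (Fin n → ℂ) → (Fin n → ℂ)}
    (hF0 : F 0 = 0) {lam : Fin n → ℂ} {q k : ℕ}
    (h : HasResonantForm F lam 1 (Finsupp.single 0 q) k) :
    ∃ a ≠ 0, ∃ h, IsSemiconjugacy F (lam 0) a (q * k + 1) (q * k + 2) h := by
  obtain ⟨-, G, hG, a, ⟨j, hj, ha⟩, hcoeff⟩ := h
  have hj0 : j = 0 := by
    ext
    simpa using hj
  subst hj0
  refine ⟨a 0, ha, hG.exists_isSemiconjugacy hF0 (by omega) (j := 0) ?_⟩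
  refine natCast_le_order_iff.2 fun d hd => ?_
  rw [map_sub, hcoeff 0 (by simp) d (by simpa using hd), sub_eq_zero]
  rw [Finsupp.smul_single, ← Finsupp.single_add, smul_eq_mul, mul_comm k q]

/-- Here the error can be pushed to any order. Since `a = 0`, the exponent `m` is immaterial;
leaving it free lets the estimates for the resonant case apply with every exponent. -/
lemma FormallyLinearizable.exists_isSemiconjugacy [NeZero n] {F : (Fin n → ℂ) → (Fin n → ℂ)}
    (hF0 : F 0 = 0) {lam : Fin n → ℂ} (h : FormallyLinearizable F lam 1) {N : ℕ} (hN : 2 ≤ N)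
    (m : ℕ) : ∃ h, IsSemiconjugacy F (lam 0) 0 m N h := by
  obtain ⟨G, hG, hG0⟩ := h
  refine hG.exists_isSemiconjugacy hF0 hN (j := 0) ?_
  simp [hG0 0 (by simp)]

end Jets

/-! ### Expansion of the defect from being fixed along a curve. -/

section FixedCurve

open Asymptotics

lemma isBigO_pow_sub_pow {E : Type*} {l : Filter E} {u v : E → ℂ} {w w' : E → ℝ}
    (hu : u =O[l] w) (hv : v =O[l] w) (huv : (fun x => u x - v x) =O[l] w') (m : ℕ) :
    (fun x => u x ^ (m + 1) - v x ^ (m + 1)) =O[l] fun x => w x ^ m * w' x := by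
  induction m with
  | zero => simpa using huv
  | succ m ih =>
    have h1 := (hu.pow (m + 1)).mul huv
    have h2 := (ih.mul hv).trans_eventuallyEq (g₂ := fun x => w x ^ (m + 1) * w' x)
      (.of_forall fun x => by ring)
    refine (h1.add h2).congr_left fun x => ?_
    ring

lemma isLittleO_pow_sub_pow {E : Type*} {l : Filter E} {u v w : E → ℂ}
    (hu : u =O[l] w) (hv : v =O[l] w) (huv : (fun x => u x - v x) =o[l] w) (m : ℕ) :
    (fun x => u x ^ (m + 1) - v x ^ (m + 1)) =o[l] fun x => w x ^ (m + 1) := by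
  induction m with
  | zero => simpa using huv
  | succ m ih =>
    have h1 := ((hu.pow (m + 1)).mul_isLittleO huv)
    have h2 := ih.mul_isBigO hv
    refine ((h1.add h2).congr_left fun x => ?_).congr_right fun x => ?_
    · ring
    · ring

variable {n : ℕ}

lemma IsSemiconjugacy.isBigO_norm {F : (Fin n → ℂ) → (Fin n → ℂ)} {μ a : ℂ} {m N : ℕ}
    {h : (Fin n → ℂ) → ℂ} (hh : IsSemiconjugacy F μ a m N h) :
    h =O[𝓝 0] fun z => ‖z‖ := by
  have := hh.analyticAt.differentiableAt.isBigO_sub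
  simpa [hh.map_zero] using this.norm_right

lemma isBigO_norm_of_map_zero {F : (Fin n → ℂ) → (Fin n → ℂ)} (hF : DifferentiableAt ℂ F 0)
    (hF0 : F 0 = 0) : (fun z => ‖F z‖) =O[𝓝 0] fun z => ‖z‖ := by
  have := hF.isBigO_sub
  simpa [hF0] using this.norm_right.norm_left

lemma tendsto_of_map_zero {F : (Fin n → ℂ) → (Fin n → ℂ)} (hF : DifferentiableAt ℂ F 0)
    (hF0 : F 0 = 0) : Tendsto F (𝓝 0) (𝓝 0) := by
  have := hF.continuousAt.tendsto
  rwa [hF0] at this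

lemma IsSemiconjugacy.isBigO_sub_sq {F : (Fin n → ℂ) → (Fin n → ℂ)} {μ a : ℂ} {d : ℕ}
    (hd : 1 ≤ d) {h : (Fin n → ℂ) → ℂ} (hh : IsSemiconjugacy F μ a (d + 1) (d + 2) h) :
    (fun z => h (F z) - μ * h z) =O[𝓝 0] fun z => ‖z‖ ^ 2 := by
  have hle (m : ℕ) (hm : 2 ≤ m) :
      (fun z : Fin n → ℂ => ‖z‖ ^ m) =O[𝓝 0] fun z => ‖z‖ ^ 2 := by
    refine IsBigO.of_bound 1 ?_
    filter_upwards [Metric.ball_mem_nhds (0 : Fin n → ℂ) one_pos] with z hz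
    rw [norm_pow, norm_pow, norm_norm, one_mul]
    exact pow_le_pow_of_le_one (norm_nonneg _) (mem_ball_zero_iff.1 hz).le hm
  have h1 := hh.isBigO.trans (hle (d + 2) (by omega))
  have h2 := ((hh.isBigO_norm.pow (d + 1)).trans (hle (d + 1) (by omega))).const_mul_left a
  refine (h1.add h2).congr_left fun z => ?_
  ring

/-- To first order, `h ∘ F = lam 0 * h` says that the differential of `h` is a left eigenvector of
the diagonal differential of `F`; as the eigenvalue `lam 0` is simple, it kills all other basis
vectors. -/
lemma IsSemiconjugacy.exists_hasFDerivAt [NeZero n]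
    {F : (Fin n → ℂ) → (Fin n → ℂ)} {lam : Fin n → ℂ}
    (hF : DifferentiableAt ℂ F 0) (hF0 : F 0 = 0)
    (hdiag : ∀ v j, fderiv ℂ F 0 v j = lam j * v j) (hlam : ∀ j, j ≠ 0 → lam j ≠ lam 0)
    {a : ℂ} {d : ℕ} (hd : 1 ≤ d) {h : (Fin n → ℂ) → ℂ}
    (hh : IsSemiconjugacy F (lam 0) a (d + 1) (d + 2) h) :
    ∃ c ≠ 0, ∀ v, fderiv ℂ h 0 v = c * v 0 := by
  classical
  have hd0 : HasFDerivAt (fun z => h (F z) - lam 0 * h z)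
      ((fderiv ℂ h 0).comp (fderiv ℂ F 0) - lam 0 • fderiv ℂ h 0) 0 := by
    refine HasFDerivAt.fun_sub ?_ (hh.analyticAt.differentiableAt.hasFDerivAt.const_mul _)
    refine HasFDerivAt.comp 0 ?_ hF.hasFDerivAt
    rw [hF0]
    exact hh.analyticAt.differentiableAt.hasFDerivAt
  have hz : HasFDerivAt (fun z => h (F z) - lam 0 * h z) (0 : (Fin n → ℂ) →L[ℂ] ℂ) 0 := by
    refine IsBigO.hasFDerivAt (n := 2) ?_ one_lt_two
    simpa using hh.isBigO_sub_sq hd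
  have heq := hd0.unique hz
  have hj (j : Fin n) (hj : j ≠ 0) : fderiv ℂ h 0 (Pi.single j 1) = 0 := by
    have h1 := DFunLike.congr_fun heq (Pi.single j 1)
    have h2 : fderiv ℂ F 0 (Pi.single j 1) = lam j • Pi.single j 1 := by
      ext i
      rw [hdiag]
      by_cases hij : i = j
      · subst hij
        simp
      · simp [hij]
    have h3 : (lam j - lam 0) * fderiv ℂ h 0 (Pi.single j 1) = 0 := by
      have : fderiv ℂ h 0 (fderiv ℂ F 0 (Pi.single j 1)) -
          lam 0 * fderiv ℂ h 0 (Pi.single j 1) = 0 := h1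
      rw [h2, map_smul, smul_eq_mul] at this
      rw [sub_mul]
      exact this
    exact (mul_eq_zero.1 h3).resolve_left (sub_ne_zero.2 (hlam j hj))
  have hv (v : Fin n → ℂ) : fderiv ℂ h 0 v = fderiv ℂ h 0 (Pi.single 0 1) * v 0 := by
    have hsum : v = ∑ i, v i • (Pi.single i 1 : Fin n → ℂ) := by
      ext j
      simp [Finset.sum_apply, Pi.single_apply]
    conv_lhs => rw [hsum]
    rw [map_sum, Finset.sum_eq_single 0]
    · rw [map_smul, smul_eq_mul, mul_comm]
    · intro j _ hj0
      rw [map_smul, hj j hj0, smul_zero]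
    · simp
  refine ⟨_, ?_, hv⟩
  intro h0
  refine hh.fderiv_ne_zero (ContinuousLinearMap.ext fun v => ?_)
  rw [hv, h0, zero_mul]
  rfl

/-- Because `μ ^ (d + 1) = μ`, the term `h ^ (d + 1)` is scaled by the same factor as `h`, and every
iteration contributes the same increment `a / μ`. -/
lemma IsSemiconjugacy.isBigO_iterate {F : (Fin n → ℂ) → (Fin n → ℂ)} (hF : DifferentiableAt ℂ F 0)
    (hF0 : F 0 = 0) {μ a : ℂ} (hμ : μ ≠ 0) {d : ℕ} (hd : 1 ≤ d) (hμd : μ ^ d = 1)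
    {h : (Fin n → ℂ) → ℂ} (hh : IsSemiconjugacy F μ a (d + 1) (d + 2) h) (i : ℕ) :
    (fun z => h (F^[i] z) - μ ^ i * (h z + i * (a / μ) * h z ^ (d + 1))) =O[𝓝 0]
      fun z => ‖z‖ ^ (d + 2) := by
  induction i with
  | zero => simpa using isBigO_zero _ _
  | succ i ih =>
    have hFO := isBigO_norm_of_map_zero hF hF0
    have h1 := (ih.comp_tendsto (tendsto_of_map_zero hF hF0)).trans (hFO.pow (d + 2))
    have h2 := hh.isBigO.const_mul_left (μ ^ i)
    have hhF : (fun z => h (F z)) =O[𝓝 0] fun z => ‖z‖ :=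
      (hh.isBigO_norm.comp_tendsto (tendsto_of_map_zero hF hF0)).trans hFO
    have h3 := (isBigO_pow_sub_pow hhF (hh.isBigO_norm.const_mul_left μ) (hh.isBigO_sub_sq hd)
      d).const_mul_left (μ ^ i * i * (a / μ))
    have h4 := (h1.add h2).add (h3.congr_right fun z => by rw [← pow_add])
    refine h4.congr_left fun z => ?_
    simp only [Function.comp_apply, Function.iterate_succ_apply, mul_pow, pow_succ, hμd]
    push_cast
    field_simp
    ring

/-- The defect from being fixed by `F^[q]` along a curve transverse to `h = 0`. -/
lemma IsSemiconjugacy.isLittleO_defect [NeZero n]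
    {F : (Fin n → ℂ) → (Fin n → ℂ)} {lam : Fin n → ℂ}
    (hF : DifferentiableAt ℂ F 0) (hF0 : F 0 = 0)
    (hdiag : ∀ v j, fderiv ℂ F 0 v j = lam j * v j) (hlam : ∀ j, j ≠ 0 → lam j ≠ lam 0)
    {q : ℕ} (hq : lam 0 ^ q = 1) {a : ℂ} {d : ℕ} (hd : 1 ≤ d) (hqd : lam 0 ^ d = 1)
    {h : (Fin n → ℂ) → ℂ} (hh : IsSemiconjugacy F (lam 0) a (d + 1) (d + 2) h)
    {γ : ℂ → (Fin n → ℂ)} {v : Fin n → ℂ} (hγ : HasDerivAt γ v 0) (hγ0 : γ 0 = 0) {g : ℂ → ℂ}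
    (hg : ∀ᶠ t in 𝓝 0, F^[q] (γ t) = γ t + Pi.single 0 (g t)) :
    ∃ c ≠ 0, (fun t => g t - q * (a / lam 0) * c ^ d * v 0 ^ (d + 1) * t ^ (d + 1)) =o[𝓝 0]
      fun t => t ^ (d + 1) := by
  have hlam0 : lam 0 ≠ 0 := by
    intro h0
    rw [h0, zero_pow (by omega)] at hqd
    exact zero_ne_one hqd
  obtain ⟨c, hc, hdh⟩ := hh.exists_hasFDerivAt hF hF0 hdiag hlam hd
  refine ⟨c, hc, ?_⟩
  have hγt : Tendsto γ (𝓝 0) (𝓝 0) := by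
    have := hγ.continuousAt.tendsto
    rwa [hγ0] at this
  have hK : Tendsto F^[q] (𝓝 0) (𝓝 0) := by
    have : ContinuousAt F^[q] 0 := ContinuousAt.iterate hF.continuousAt hF0 q
    have h2 := this.tendsto
    rwa [Function.iterate_fixed hF0] at h2
  -- Strict differentiability compares `h` at two moving points whose difference is `g t` times the
  -- first basis vector, with an error measured by `g` itself.
  have hA : (fun t => h (F^[q] (γ t)) - h (γ t) - c * g t) =o[𝓝 0] g := by
    have h1 : HasStrictFDerivAt h (fderiv ℂ h 0) 0 := hh.analyticAt.hasStrictFDerivAt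
    have h2 := h1.isLittleO.comp_tendsto
      (k := fun t => (F^[q] (γ t), γ t)) (by
        rw [nhds_prod_eq]
        exact (hK.comp hγt).prodMk hγt)
    refine (h2.congr' ?_ .rfl).trans_isBigO ?_
    · filter_upwards [hg] with t ht
      simp only [Function.comp_apply]
      rw [hdh, ht]
      simp
    · refine IsBigO.of_bound 1 ?_
      filter_upwards [hg] with t ht
      simp only [Function.comp_apply]
      rw [ht, add_sub_cancel_left, Pi.norm_single, one_mul]
  have hγO : (fun t => ‖γ t‖) =O[𝓝 0] fun t : ℂ => t := by
    have := hγ.differentiableAt.isBigO_sub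
    simpa [hγ0] using this.norm_left
  have hB : (fun t => h (F^[q] (γ t)) - h (γ t) - q * (a / lam 0) * h (γ t) ^ (d + 1)) =o[𝓝 0]
      fun t : ℂ => t ^ (d + 1) := by
    have h1 := ((hh.isBigO_iterate hF hF0 hlam0 hd hqd q).comp_tendsto hγt).trans
      (hγO.pow (d + 2))
    refine (h1.congr_left fun t => ?_).trans_isLittleO ?_
    · simp only [Function.comp_apply, hq]
      ring
    · exact isLittleO_pow_pow (by omega)
  have hderiv : HasDerivAt (fun t => h (γ t)) (c * v 0) 0 := by
    rw [← hdh]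
    refine HasFDerivAt.comp_hasDerivAt 0 ?_ hγ
    rw [hγ0]
    exact hh.analyticAt.differentiableAt.hasFDerivAt
  have hC0 : (fun t => h (γ t) - c * v 0 * t) =o[𝓝 0] fun t : ℂ => t := by
    have := hderiv.isLittleO
    simpa [hγ0, hh.map_zero, mul_comm] using this
  have hlin : (fun t : ℂ => c * v 0 * t) =O[𝓝 0] fun t : ℂ => t :=
    (isBigO_refl _ _).const_mul_left _
  have hhγ : (fun t => h (γ t)) =O[𝓝 0] fun t : ℂ => t :=
    (hC0.isBigO.add hlin).congr_left fun t => by ring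
  have hC := isLittleO_pow_sub_pow hhγ hlin hC0 d
  have hL : (fun t => h (F^[q] (γ t)) - h (γ t)) =O[𝓝 0] fun t : ℂ => t ^ (d + 1) :=
    (hB.isBigO.add ((hhγ.pow (d + 1)).const_mul_left (q * (a / lam 0)))).congr_left
      fun t => by ring
  -- The error `o(g)` in `hA` is absorbed since `c ≠ 0`, so `g` inherits the bound on the increment
  -- of `h`.
  have hgO : g =O[𝓝 0] fun t : ℂ => t ^ (d + 1) := by
    have h1 : (fun t => h (F^[q] (γ t)) - h (γ t) - c * g t) =o[𝓝 0] fun t => c * g t :=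
      hA.trans_isBigO (isBigO_const_mul_self c⁻¹ (fun t => c * g t) _ |>.congr_left
        fun t => by field_simp)
    have h2 := h1.right_isBigO_add
    have h3 : g =O[𝓝 0] fun t => c * g t :=
      (isBigO_const_mul_self c⁻¹ (fun t => c * g t) _).congr_left fun t => by field_simp
    exact h3.trans ((h2.congr_right fun t => by ring).trans hL)
  have hfin := ((hB.sub (hA.trans_isBigO hgO)).add
    (hC.const_mul_left (q * (a / lam 0)))).const_mul_left c⁻¹
  refine hfin.congr_left fun t => ?_
  field_simp
  ring

end FixedCurve

/-! ### The order is well defined; fixed curves and formal linearizability. -/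

section Order

open Asymptotics

variable {n : ℕ}

lemma AnalyticAt.iterate_of_fixed {F : (Fin n → ℂ) → (Fin n → ℂ)} (hF : AnalyticAt ℂ F 0)
    (hF0 : F 0 = 0) (i : ℕ) : AnalyticAt ℂ F^[i] 0 := by
  induction i with
  | zero => exact analyticAt_id
  | succ i ih =>
    rw [Function.iterate_succ]
    exact AnalyticAt.comp (by rwa [hF0]) hF

lemma fderiv_iterate_apply {F : (Fin n → ℂ) → (Fin n → ℂ)} (hF : DifferentiableAt ℂ F 0)
    (hF0 : F 0 = 0) {lam : Fin n → ℂ} (hdiag : ∀ v j, fderiv ℂ F 0 v j = lam j * v j) (i : ℕ)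
    (v : Fin n → ℂ) (j : Fin n) : fderiv ℂ F^[i] 0 v j = lam j ^ i * v j := by
  rw [(hF.hasFDerivAt.iterate hF0 i).fderiv]
  induction i with
  | zero => simp
  | succ i ih =>
    rw [pow_succ', _root_.mul_apply_eq_comp, hdiag, ih]
    ring

/-- The diagonal continuous linear equivalence with given nonzero entries. -/
noncomputable def diagonalEquiv (u : Fin n → ℂ) (hu : ∀ j, u j ≠ 0) :
    (Fin n → ℂ) ≃L[ℂ] (Fin n → ℂ) :=
  ContinuousLinearEquiv.piCongrRight fun j =>
    ContinuousLinearEquiv.unitsEquivAut ℂ (Units.mk0 (u j) (hu j))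

lemma diagonalEquiv_apply (u : Fin n → ℂ) (hu : ∀ j, u j ≠ 0) (v : Fin n → ℂ) (j : Fin n) :
    diagonalEquiv u hu v j = u j * v j := by
  simp [diagonalEquiv, mul_comm]

/-- Away from the neutral direction the fixed point equation can be solved. -/
lemma exists_curve_fixed_up_to_first [NeZero n] {K : (Fin n → ℂ) → (Fin n → ℂ)}
    (hK : AnalyticAt ℂ K 0) (hK0 : K 0 = 0) {κ : Fin n → ℂ}
    (hdiag : ∀ v j, fderiv ℂ K 0 v j = κ j * v j) (hκ : ∀ j, j ≠ 0 → κ j ≠ 1) :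
    ∃ (γ : ℂ → (Fin n → ℂ)) (g : ℂ → ℂ), AnalyticAt ℂ γ 0 ∧ γ 0 = 0 ∧ deriv γ 0 0 = 1 ∧
      AnalyticAt ℂ g 0 ∧ ∀ᶠ t in 𝓝 0, K (γ t) = γ t + Pi.single 0 (g t) := by
  classical
  -- The differential of `Ψ` is diagonal with entries `1` and `1 - κ j`, hence invertible, and `γ`
  -- is the preimage under `Ψ` of the first coordinate axis.
  let Ψ : (Fin n → ℂ) → (Fin n → ℂ) := fun z j => if j = 0 then z 0 else z j - K z j
  let u : Fin n → ℂ := fun j => if j = 0 then 1 else 1 - κ j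
  have hu (j : Fin n) : u j ≠ 0 := by
    by_cases hj : j = 0
    · simp [u, hj]
    · simpa [u, hj] using sub_ne_zero.2 (hκ j hj).symm
  have hKj (j : Fin n) : AnalyticAt ℂ (fun z => K z j) 0 := analyticAt_pi_iff.1 hK j
  have hproj (j : Fin n) : AnalyticAt ℂ (fun z : Fin n → ℂ => z j) 0 :=
    (ContinuousLinearMap.proj (R := ℂ) (φ := fun _ : Fin n => ℂ) j).analyticAt 0
  have hΨ : AnalyticAt ℂ Ψ 0 := by
    refine analyticAt_pi_iff.2 fun j => ?_
    by_cases hj : j = 0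
    · simpa [Ψ, hj] using hproj 0
    · simpa [Ψ, hj] using (hproj j).fun_sub (hKj j)
  have hΨ' : HasFDerivAt Ψ (diagonalEquiv u hu : (Fin n → ℂ) →L[ℂ] (Fin n → ℂ)) 0 := by
    refine hasFDerivAt_pi'.2 fun j => ?_
    have hp (j : Fin n) : HasFDerivAt (fun z : Fin n → ℂ => z j)
        (ContinuousLinearMap.proj (R := ℂ) (φ := fun _ : Fin n => ℂ) j) 0 :=
      (ContinuousLinearMap.proj (R := ℂ) (φ := fun _ : Fin n => ℂ) j).hasFDerivAt
    by_cases hj : j = 0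
    · subst hj
      simp only [Ψ, if_true]
      refine (hp 0).congr_fderiv (ContinuousLinearMap.ext fun v => ?_)
      simp [diagonalEquiv_apply, u]
    · simp only [Ψ, if_neg hj]
      refine ((hp j).fun_sub (hasFDerivAt_pi'.1 hK.differentiableAt.hasFDerivAt j)).congr_fderiv
        (ContinuousLinearMap.ext fun v => ?_)
      simp [diagonalEquiv_apply, u, hj, hdiag, sub_mul]
  have hΨ0 : Ψ 0 = 0 := by
    ext j
    simp [Ψ, hK0]
  have hs : HasStrictFDerivAt Ψ (diagonalEquiv u hu : (Fin n → ℂ) →L[ℂ] (Fin n → ℂ)) 0 := by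
    have := hΨ.hasStrictFDerivAt
    rwa [hΨ'.fderiv] at this
  let e := hs.toOpenPartialHomeomorph Ψ
  have he : ⇑e = Ψ := hs.toOpenPartialHomeomorph_coe
  have he0 : (0 : Fin n → ℂ) ∈ e.source := hs.mem_toOpenPartialHomeomorph_source
  have hsymm0 : e.symm 0 = 0 := by
    have := e.left_inv he0
    rwa [he, hΨ0] at this
  have hsymm : AnalyticAt ℂ e.symm 0 := by
    have := e.analyticAt_symm' he0 (by rw [he]; exact hΨ) (by rw [he]; exact hΨ'.fderiv)
    rwa [he, hΨ0] at this
  let ι : ℂ → (Fin n → ℂ) := fun t => Pi.single 0 t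
  have hι : AnalyticAt ℂ ι 0 :=
    (ContinuousLinearMap.single ℂ (fun _ : Fin n => ℂ) 0).analyticAt 0
  have hι0 : ι 0 = 0 := by simp [ι]
  let γ : ℂ → (Fin n → ℂ) := fun t => e.symm (ι t)
  have hγ : AnalyticAt ℂ γ 0 := AnalyticAt.comp (by rwa [hι0]) hι
  have hγ0 : γ 0 = 0 := by simp [γ, hι0, hsymm0]
  have hΨγ : ∀ᶠ t in 𝓝 (0 : ℂ), Ψ (γ t) = ι t := by
    have h1 : ∀ᶠ y in 𝓝 (0 : Fin n → ℂ), y ∈ e.target := by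
      refine e.open_target.mem_nhds ?_
      have := e.map_source he0
      rwa [he, hΨ0] at this
    have h2 : Tendsto ι (𝓝 0) (𝓝 0) := by
      have := hι.continuousAt.tendsto
      rwa [hι0] at this
    filter_upwards [h2.eventually h1] with t ht
    rw [← he]
    exact e.right_inv ht
  refine ⟨γ, fun t => K (γ t) 0 - γ t 0, hγ, hγ0, ?_, ?_, ?_⟩
  · have h1 : HasDerivAt (fun t => γ t 0) (deriv γ 0 0) 0 :=
      hasDerivAt_pi.1 hγ.differentiableAt.hasDerivAt 0
    have h2 : HasDerivAt (fun t => γ t 0) 1 0 := by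
      refine (hasDerivAt_id (0 : ℂ)).congr_of_eventuallyEq ?_
      filter_upwards [hΨγ] with t ht
      have := congrFun ht 0
      simpa [Ψ, ι] using this
    exact h1.unique h2
  · refine AnalyticAt.fun_sub ?_ (analyticAt_pi_iff.1 hγ 0)
    exact AnalyticAt.comp (f := γ) (g := fun z => K z 0) (by rw [hγ0]; exact hKj 0) hγ
  · filter_upwards [hΨγ] with t ht
    ext j
    by_cases hj : j = 0
    · subst hj
      simp
    · have := congrFun ht j
      simp only [Ψ, if_neg hj, ι, Pi.single_apply] at this
      simp only [Pi.add_apply, Pi.single_apply, if_neg hj, add_zero]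
      exact (sub_eq_zero.1 this).symm

lemma eq_zero_of_isLittleO_const_mul {b : ℂ} {m : ℕ}
    (h : (fun t : ℂ => b * t ^ m) =o[𝓝 0] fun t : ℂ => t ^ m) : b = 0 := by
  by_contra hb
  have h1 : (fun t : ℂ => t ^ m) =o[𝓝 0] fun t : ℂ => t ^ m :=
    (h.const_mul_left b⁻¹).congr_left fun t => by field_simp
  have h2 := isLittleO_irrefl (l := 𝓝[≠] (0 : ℂ)) (f'' := fun t : ℂ => t ^ m) (by
    refine Eventually.frequently ?_
    filter_upwards [self_mem_nhdsWithin] with t ht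
    exact pow_ne_zero m ht)
  exact h2 (h1.mono nhdsWithin_le_nhds)

/-- Otherwise `g = t ^ m * u` with `u 0 ≠ 0`, which is not `o(t ^ m)`. -/
lemma AnalyticAt.eventually_eq_zero_of_isBigO {g : ℂ → ℂ} (hg : AnalyticAt ℂ g 0)
    (h : ∀ m : ℕ, ∃ m' ≥ m, g =O[𝓝 0] fun t : ℂ => t ^ m') : ∀ᶠ t in 𝓝 0, g t = 0 := by
  by_contra hne
  obtain ⟨m, u, hu, hu0, hgu⟩ := hg.exists_eventuallyEq_pow_smul_nonzero_iff.2 hne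
  obtain ⟨m', hm', hO⟩ := h (m + 1)
  have h1 : g =o[𝓝 0] fun t : ℂ => t ^ m := hO.trans_isLittleO (isLittleO_pow_pow (by omega))
  have h2 : (fun t => u t - u 0) =o[𝓝 0] fun _ => (1 : ℂ) := by
    rw [isLittleO_one_iff]
    have := hu.continuousAt.tendsto.sub_const (u 0)
    rwa [sub_self] at this
  have h3 := (isBigO_refl (fun t : ℂ => t ^ m) (𝓝 0)).mul_isLittleO h2
  simp only [mul_one] at h3
  refine hu0 (eq_zero_of_isLittleO_const_mul (m := m) ((h1.sub h3).congr' ?_ .rfl))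
  filter_upwards [hgu] with t ht
  rw [ht]
  simp only [sub_zero, smul_eq_mul]
  ring

/-- The hypotheses on the eigenvalues and on the differential. -/
structure IsQuasiParabolic [NeZero n] (F : (Fin n → ℂ) → (Fin n → ℂ)) (lam : Fin n → ℂ) (q : ℕ) :
    Prop where
  analyticAt : AnalyticAt ℂ F 0
  map_zero : F 0 = 0
  fderiv_apply : ∀ v j, fderiv ℂ F 0 v j = lam j * v j
  pos : 0 < q
  isPrimitiveRoot : IsPrimitiveRoot (lam 0) q
  norm_lt_one : ∀ j : Fin n, j ≠ 0 → ‖lam j‖ < 1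

namespace IsQuasiParabolic

variable [NeZero n] {F : (Fin n → ℂ) → (Fin n → ℂ)} {lam : Fin n → ℂ} {q : ℕ}

lemma norm_lam_zero (hF : IsQuasiParabolic F lam q) : ‖lam 0‖ = 1 :=
  hF.isPrimitiveRoot.norm'_eq_one hF.pos.ne'

lemma lam_ne (hF : IsQuasiParabolic F lam q) (j : Fin n) (hj : j ≠ 0) : lam j ≠ lam 0 := by
  intro h
  have := hF.norm_lt_one j hj
  rw [h, hF.norm_lam_zero] at this
  exact lt_irrefl _ this

lemma lam_pow_ne_one (hF : IsQuasiParabolic F lam q) (j : Fin n) (hj : j ≠ 0) :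
    lam j ^ q ≠ 1 := by
  intro h
  have h1 := pow_lt_one₀ (norm_nonneg _) (hF.norm_lt_one j hj) hF.pos.ne'
  rw [← norm_pow, h, norm_one] at h1
  exact lt_irrefl _ h1

/-- Any factor of norm less than one would make the product too small, so `l` is supported on the
first index; then `lam 0 ^ (l 0 - 1) = 1` means that `q` divides `l 0 - 1`. -/
lemma isOneResonant (hF : IsQuasiParabolic F lam q) :
    IsOneResonant lam 1 (Finsupp.single 0 q) := by
  classical
  refine ⟨by simpa using hF.pos.ne', fun j hj => ?_, fun j hj l => ?_⟩
  · have : j ≠ 0 := by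
      rintro rfl
      simp at hj
    simp [this]
  · have hj0 : j = 0 := by
      ext
      simpa using hj
    subst hj0
    constructor
    · rintro ⟨hdeg, hl⟩
      rw [Finsupp.prod_fintype _ _ (by simp)] at hl
      have hnorm : (∏ i, ‖lam i‖ ^ l i) = 1 := by
        simpa [hF.norm_lam_zero] using (congrArg norm hl).symm
      have hle (i : Fin n) : ‖lam i‖ ^ l i ≤ 1 := by
        by_cases hi : i = 0
        · simp [hi, hF.norm_lam_zero]
        · exact pow_le_one₀ (norm_nonneg _) (hF.norm_lt_one i hi).le
      have hl0 (i : Fin n) (hi : i ≠ 0) : l i = 0 := by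
        by_contra hli
        have h1 : ‖lam i‖ ^ l i < 1 := pow_lt_one₀ (norm_nonneg _) (hF.norm_lt_one i hi) hli
        have h2 := Finset.mul_prod_erase Finset.univ (fun i => ‖lam i‖ ^ l i) (Finset.mem_univ i)
        have h3 : ∏ x ∈ Finset.univ.erase i, ‖lam x‖ ^ l x ≤ 1 :=
          Finset.prod_le_one (fun _ _ => by positivity) fun x _ => hle x
        have h4 : 0 ≤ ‖lam i‖ ^ l i := by positivity
        have h5 : ‖lam i‖ ^ l i * ∏ x ∈ Finset.univ.erase i, ‖lam x‖ ^ l x ≤ ‖lam i‖ ^ l i :=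
          mul_le_of_le_one_right h4 h3
        rw [h2, hnorm] at h5
        linarith
      have hls : l = Finsupp.single 0 (l 0) := by
        ext i
        by_cases hi : i = 0
        · simp [hi]
        · simp [hi, hl0 i hi]
      rw [Finset.prod_eq_single 0 (fun i _ hi => by rw [hl0 i hi, pow_zero]) (by simp)] at hl
      rw [hls, Finsupp.degree_single] at hdeg
      have hpow : lam 0 ^ (l 0 - 1) = 1 := by
        have h0 : lam 0 ≠ 0 := hF.isPrimitiveRoot.ne_zero hF.pos.ne'
        apply mul_left_cancel₀ h0
        rw [← pow_succ', Nat.sub_add_cancel (by omega), ← hl, mul_one]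
      obtain ⟨k, hk⟩ := hF.isPrimitiveRoot.dvd_of_pow_eq_one _ hpow
      refine ⟨k, ?_, ?_⟩
      · rw [Nat.one_le_iff_ne_zero]
        rintro rfl
        omega
      · rw [hls, Finsupp.smul_single, ← Finsupp.single_add, smul_eq_mul, mul_comm k q, ← hk,
          Nat.sub_add_cancel (by omega)]
    · rintro ⟨k, hk, rfl⟩
      rw [Finsupp.smul_single, ← Finsupp.single_add]
      refine ⟨?_, ?_⟩
      · rw [Finsupp.degree_single, smul_eq_mul]
        have := Nat.mul_pos hk hF.pos
        omega
      · rw [Finsupp.prod_single_index (by simp), smul_eq_mul, pow_succ, mul_comm k q, pow_mul,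
          hF.isPrimitiveRoot.pow_eq_one, one_pow, one_mul]

lemma pow_mul_eq_one (hF : IsQuasiParabolic F lam q) (k : ℕ) : lam 0 ^ (q * k) = 1 := by
  rw [pow_mul, hF.isPrimitiveRoot.pow_eq_one, one_pow]

lemma exists_isLittleO_of_hasResonantForm (hF : IsQuasiParabolic F lam q) {k : ℕ}
    (hk : HasResonantForm F lam 1 (Finsupp.single 0 q) k) {γ : ℂ → (Fin n → ℂ)} {v : Fin n → ℂ}
    (hγ : HasDerivAt γ v 0) (hγ0 : γ 0 = 0) (hv : v 0 ≠ 0) {g : ℂ → ℂ}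
    (hg : ∀ᶠ t in 𝓝 0, F^[q] (γ t) = γ t + Pi.single 0 (g t)) :
    ∃ b ≠ 0, (fun t => g t - b * t ^ (q * k + 1)) =o[𝓝 0] fun t => t ^ (q * k + 1) := by
  obtain ⟨a, ha, h, hh⟩ := hk.exists_isSemiconjugacy hF.map_zero
  obtain ⟨c, hc, hO⟩ := hh.isLittleO_defect hF.analyticAt.differentiableAt hF.map_zero
    hF.fderiv_apply hF.lam_ne hF.isPrimitiveRoot.pow_eq_one (Nat.mul_pos hF.pos hk.1)
    (hF.pow_mul_eq_one k) hγ hγ0 hg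
  have h0 : lam 0 ≠ 0 := hF.isPrimitiveRoot.ne_zero hF.pos.ne'
  have hq0 : (q : ℂ) ≠ 0 := Nat.cast_ne_zero.2 hF.pos.ne'
  exact ⟨_, by positivity, hO⟩

lemma isBigO_of_formallyLinearizable (hF : IsQuasiParabolic F lam q)
    (hL : FormallyLinearizable F lam 1) {γ : ℂ → (Fin n → ℂ)} {v : Fin n → ℂ}
    (hγ : HasDerivAt γ v 0) (hγ0 : γ 0 = 0) {g : ℂ → ℂ}
    (hg : ∀ᶠ t in 𝓝 0, F^[q] (γ t) = γ t + Pi.single 0 (g t)) {k : ℕ} (hk : 1 ≤ k) :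
    g =O[𝓝 0] fun t => t ^ (q * k + 1) := by
  obtain ⟨h, hh⟩ := hL.exists_isSemiconjugacy hF.map_zero (N := q * k + 2) (by omega) (q * k + 1)
  obtain ⟨c, hc, hO⟩ := hh.isLittleO_defect hF.analyticAt.differentiableAt hF.map_zero
    hF.fderiv_apply hF.lam_ne hF.isPrimitiveRoot.pow_eq_one (Nat.mul_pos hF.pos hk)
    (hF.pow_mul_eq_one k) hγ hγ0 hg
  simpa using hO.isBigO

lemma exists_curve (hF : IsQuasiParabolic F lam q) :
    ∃ (γ : ℂ → (Fin n → ℂ)) (g : ℂ → ℂ), AnalyticAt ℂ γ 0 ∧ γ 0 = 0 ∧ deriv γ 0 0 = 1 ∧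
      AnalyticAt ℂ g 0 ∧ ∀ᶠ t in 𝓝 0, F^[q] (γ t) = γ t + Pi.single 0 (g t) :=
  exists_curve_fixed_up_to_first (hF.analyticAt.iterate_of_fixed hF.map_zero q)
    (Function.iterate_fixed hF.map_zero q)
    (fderiv_iterate_apply hF.analyticAt.differentiableAt hF.map_zero hF.fderiv_apply q)
    hF.lam_pow_ne_one

/-- The curve and its defect `g` depend on `F` alone, and both `q * k + 1` and `q * k' + 1` would be
the order of vanishing of `g`. -/
lemma eq_of_hasResonantForm (hF : IsQuasiParabolic F lam q) {k k' : ℕ}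
    (hk : HasResonantForm F lam 1 (Finsupp.single 0 q) k)
    (hk' : HasResonantForm F lam 1 (Finsupp.single 0 q) k') : k = k' := by
  wlog hlt : k < k' generalizing k k'
  · by_contra hne
    exact hne (this hk' hk (by omega)).symm
  exfalso
  obtain ⟨γ, g, hγ, hγ0, hγ1, -, hgγ⟩ := hF.exists_curve
  have hv : deriv γ 0 0 ≠ 0 := by simp [hγ1]
  have hd := hγ.differentiableAt.hasDerivAt
  obtain ⟨b, hb, hO⟩ := hF.exists_isLittleO_of_hasResonantForm hk hd hγ0 hv hgγ
  obtain ⟨b', -, hO'⟩ := hF.exists_isLittleO_of_hasResonantForm hk' hd hγ0 hv hgγ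
  have h1 : g =O[𝓝 0] fun t : ℂ => t ^ (q * k' + 1) :=
    (hO'.isBigO.add ((isBigO_refl _ _).const_mul_left b')).congr_left fun t => by ring
  have h2 : g =o[𝓝 0] fun t : ℂ => t ^ (q * k + 1) :=
    h1.trans_isLittleO (isLittleO_pow_pow (by
      have := Nat.mul_lt_mul_of_pos_left hlt hF.pos
      omega))
  exact hb (eq_zero_of_isLittleO_const_mul ((h2.sub hO).congr_left fun t => by ring))

lemma hasFixedCurve_of_formallyLinearizable (hF : IsQuasiParabolic F lam q)
    (hL : FormallyLinearizable F lam 1) : HasFixedCurve F^[q] := by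
  obtain ⟨γ, g, hγ, hγ0, hγ1, hg, hgγ⟩ := hF.exists_curve
  have hd := hγ.differentiableAt.hasDerivAt
  have h0 := hg.eventually_eq_zero_of_isBigO fun m =>
    ⟨q * (m + 1) + 1, by nlinarith [hF.pos],
      hF.isBigO_of_formallyLinearizable hL hd hγ0 hgγ (by omega)⟩
  refine ⟨γ, hγ, hγ0, fun h => ?_, ?_⟩
  · rw [h] at hγ1
    simp at hγ1
  · filter_upwards [h0, hgγ] with t h1 h2
    rw [h2, h1, Pi.single_zero, add_zero]

lemma not_hasResonantForm_of_hasFixedCurve (hF : IsQuasiParabolic F lam q)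
    (hC : HasFixedCurve F^[q]) (k : ℕ) : ¬ HasResonantForm F lam 1 (Finsupp.single 0 q) k := by
  intro hk
  obtain ⟨γ, hγ, hγ0, hγ1, hfix⟩ := hC
  have hd := hγ.differentiableAt.hasDerivAt
  -- The tangent of a fixed curve is fixed by the differential of `F^[q]`, whose only eigenvalue
  -- equal to `1` belongs to the first axis.
  have hv : deriv γ 0 0 ≠ 0 := by
    intro h0
    refine hγ1 (funext fun j => ?_)
    by_cases hj : j = 0
    · rw [hj, h0, Pi.zero_apply]
    · have hK : HasFDerivAt F^[q] (fderiv ℂ F^[q] 0) (γ 0) := by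
        rw [hγ0]
        exact (hF.analyticAt.iterate_of_fixed hF.map_zero q).differentiableAt.hasFDerivAt
      have h1 := (hK.comp_hasDerivAt 0 hd).unique (hd.congr_of_eventuallyEq hfix)
      have h2 := congrFun h1 j
      rw [fderiv_iterate_apply hF.analyticAt.differentiableAt hF.map_zero hF.fderiv_apply] at h2
      have h3 : (lam j ^ q - 1) * deriv γ 0 j = 0 := by
        rw [sub_mul, h2]
        ring
      exact (mul_eq_zero.1 h3).resolve_left (sub_ne_zero.2 (hF.lam_pow_ne_one j hj))
  obtain ⟨b, hb, hO⟩ := hF.exists_isLittleO_of_hasResonantForm hk hd hγ0 hv (g := fun _ => 0) (by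
    filter_upwards [hfix] with t ht
    rw [ht, Pi.single_zero, add_zero])
  exact hb (eq_zero_of_isLittleO_const_mul (hO.neg_left.congr_left fun t => by ring))

lemma formallyLinearizable_or_hasResonantForm (hF : IsQuasiParabolic F lam q) :
    FormallyLinearizable F lam 1 ∨ ∃ k, HasResonantForm F lam 1 (Finsupp.single 0 q) k := by
  obtain ⟨f, hf⟩ := exists_hasTaylorSeries hF.analyticAt
  exact _root_.formallyLinearizable_or_hasResonantForm hf
    (hf.hasDiagonalPart hF.map_zero hF.analyticAt.differentiableAt hF.fderiv_apply)
    hF.isOneResonant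

lemma formallyLinearizable_iff_hasFixedCurve (hF : IsQuasiParabolic F lam q) :
    FormallyLinearizable F lam 1 ↔ HasFixedCurve F^[q] := by
  refine ⟨hF.hasFixedCurve_of_formallyLinearizable, fun h => ?_⟩
  refine hF.formallyLinearizable_or_hasResonantForm.resolve_right ?_
  rintro ⟨k, hk⟩
  exact hF.not_hasResonantForm_of_hasFixedCurve h k hk

lemma resonanceOrder_eq (hF : IsQuasiParabolic F lam q) {k : ℕ}
    (hk : HasResonantForm F lam 1 (Finsupp.single 0 q) k) :
    resonanceOrder F lam 1 (Finsupp.single 0 q) = k := by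
  have : {x : ℕ∞ | ∃ k : ℕ, HasResonantForm F lam 1 (Finsupp.single 0 q) k ∧ x = k} =
      {(k : ℕ∞)} := by
    ext x
    constructor
    · rintro ⟨k', hk', rfl⟩
      rw [hF.eq_of_hasResonantForm hk hk', mem_singleton_iff]
    · rintro rfl
      exact ⟨k, hk, rfl⟩
  rw [resonanceOrder, this, sInf_singleton]

/-- The infimum of the empty set is `⊤`, so the dichotomy applies once the two alternatives are
known to exclude each other. -/
lemma resonanceOrder_eq_top_iff (hF : IsQuasiParabolic F lam q) :
    resonanceOrder F lam 1 (Finsupp.single 0 q) = ⊤ ↔ FormallyLinearizable F lam 1 := by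
  constructor
  · intro h
    refine hF.formallyLinearizable_or_hasResonantForm.resolve_right ?_
    rintro ⟨k, hk⟩
    rw [hF.resonanceOrder_eq hk] at h
    exact ENat.natCast_ne_top k h
  · intro h
    rw [resonanceOrder, sInf_eq_top]
    rintro x ⟨k, hk, -⟩
    exact absurd hk (hF.not_hasResonantForm_of_hasFixedCurve
      (hF.hasFixedCurve_of_formallyLinearizable h) k)

lemma hasResonantForm_of_resonanceOrder_eq (hF : IsQuasiParabolic F lam q) {k : ℕ}
    (hk : resonanceOrder F lam 1 (Finsupp.single 0 q) = k) :
    HasResonantForm F lam 1 (Finsupp.single 0 q) k := by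
  obtain h | ⟨k', hk'⟩ := hF.formallyLinearizable_or_hasResonantForm
  · rw [hF.resonanceOrder_eq_top_iff.2 h] at hk
    exact absurd hk.symm (ENat.natCast_ne_top k)
  · have := hF.resonanceOrder_eq hk'
    rw [hk] at this
    rwa [show k = k' by exact_mod_cast this]

end IsQuasiParabolic

end Order

/-! ### Attracting petals in the complex plane. -/

section Petal

/-- A branch of the inverse of `x ↦ c ^ d / x ^ d`. -/
noncomputable def petalRoot (c : ℂ) (d : ℕ) (u : ℂ) : ℂ := c * u ^ (-(d : ℂ)⁻¹)

lemma cpow_neg_inv_pow {d : ℕ} (hd : d ≠ 0) (u : ℂ) : (u ^ (-(d : ℂ)⁻¹)) ^ d = u⁻¹ := by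
  rw [← Complex.cpow_mul_nat, neg_mul, inv_mul_cancel₀ (Nat.cast_ne_zero.2 hd),
    Complex.cpow_neg_one]

lemma div_petalRoot_pow {c : ℂ} (hc : c ≠ 0) {d : ℕ} (hd : d ≠ 0) {μ : ℂ} (hμ : μ ^ d = 1)
    (u : ℂ) : c ^ d / (μ * petalRoot c d u) ^ d = u := by
  rw [petalRoot, mul_pow, mul_pow, cpow_neg_inv_pow hd, hμ, one_mul]
  field_simp

/-- Roots of unity of a given order are isolated. This identifies branches of the `d`-th root by
continuity, without tracking arguments. -/
lemma eventually_eq_one_of_pow_eq_one {X : Type*} {l : Filter X} {f : X → ℂ} {d : ℕ} (hd : d ≠ 0)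
    (hf : Tendsto f l (𝓝 1)) (hpow : ∀ᶠ x in l, f x ^ d = 1) : ∀ᶠ x in l, f x = 1 := by
  have hfin : ({y : ℂ | y ^ d = 1} \ {1}).Finite := by
    refine Set.Finite.subset (Polynomial.nthRootsFinset d (1 : ℂ)).finite_toSet fun y hy => ?_
    exact (Polynomial.mem_nthRootsFinset (Nat.pos_of_ne_zero hd) _).2 hy.1
  have h1 : ({y : ℂ | y ^ d = 1} \ {1})ᶜ ∈ 𝓝 (1 : ℂ) := hfin.isClosed.isOpen_compl.mem_nhds (by simp)
  filter_upwards [hf h1, hpow] with x hx hxd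
  by_contra hne
  exact hx ⟨hxd, hne⟩

/-- The attracting petal in direction `μ`. -/
def petal (c : ℂ) (d : ℕ) (R : ℝ) (μ : ℂ) : Set ℂ :=
  (fun u => μ * petalRoot c d u) '' {u | R < u.re}

variable {c : ℂ} {d : ℕ} {R : ℝ} {μ : ℂ}

lemma continuousAt_petalRoot {u : ℂ} (hu : 0 < u.re) : ContinuousAt (petalRoot c d) u :=
  continuousAt_const.mul (continuousAt_id.cpow continuousAt_const (Or.inl hu))

lemma petalRoot_ne_zero (hc : c ≠ 0) {u : ℂ} (hu : u ≠ 0) : petalRoot c d u ≠ 0 :=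
  mul_ne_zero hc fun h => hu ((Complex.cpow_eq_zero_iff _ _).1 h).1

/-- The parameter is recovered as `c ^ d / x ^ d`; the second condition selects the branch of the
root. -/
lemma mem_petal_iff (hc : c ≠ 0) (hd : d ≠ 0) (hμ : μ ^ d = 1) {x : ℂ} :
    x ∈ petal c d R μ ↔ R < (c ^ d / x ^ d).re ∧ x = μ * petalRoot c d (c ^ d / x ^ d) := by
  constructor
  · rintro ⟨u, hu, rfl⟩
    simp only
    rw [div_petalRoot_pow hc hd hμ]
    exact ⟨hu, rfl⟩
  · rintro ⟨h1, h2⟩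
    exact ⟨_, h1, h2.symm⟩

lemma ne_zero_of_mem_petal (hc : c ≠ 0) (hd : d ≠ 0) (hR : 0 ≤ R) (hμ : μ ^ d = 1) {x : ℂ}
    (hx : x ∈ petal c d R μ) : x ≠ 0 := by
  rintro rfl
  have := ((mem_petal_iff hc hd hμ).1 hx).1
  rw [zero_pow hd, div_zero, Complex.zero_re] at this
  linarith

lemma isOpen_petal (hc : c ≠ 0) (hd : d ≠ 0) (hR : 0 ≤ R) (hμ : μ ^ d = 1) :
    IsOpen (petal c d R μ) := by
  rw [isOpen_iff_mem_nhds]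
  intro x hx
  have hx0 := ne_zero_of_mem_petal hc hd hR hμ hx
  obtain ⟨h1, h2⟩ := (mem_petal_iff hc hd hμ).1 hx
  have hcont : ContinuousAt (fun x : ℂ => c ^ d / x ^ d) x :=
    continuousAt_const.div (continuousAt_id.pow d) (pow_ne_zero d hx0)
  have hre : ∀ᶠ y in 𝓝 x, R < (c ^ d / y ^ d).re :=
    (Complex.continuous_re.continuousAt.comp hcont).eventually_const_lt h1
  have hroot : ContinuousAt (fun y => μ * petalRoot c d (c ^ d / y ^ d) / y) x := by
    refine (continuousAt_const.mul ?_).div continuousAt_id hx0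
    exact ContinuousAt.comp (g := petalRoot c d) (f := fun x : ℂ => c ^ d / x ^ d)
      (continuousAt_petalRoot (by linarith)) hcont
  have ht : Tendsto (fun y => μ * petalRoot c d (c ^ d / y ^ d) / y) (𝓝 x) (𝓝 1) := by
    have := hroot.tendsto
    rwa [← h2, div_self hx0] at this
  -- The quotient of the branch by `y` is a `d`-th root of unity tending to `1`, so nearby points
  -- stay on the branch `μ`.
  have hone := eventually_eq_one_of_pow_eq_one hd ht (by
    filter_upwards [eventually_ne_nhds hx0] with y hy
    have hu : c ^ d / y ^ d ≠ 0 := div_ne_zero (pow_ne_zero d hc) (pow_ne_zero d hy)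
    have h3 : (μ * petalRoot c d (c ^ d / y ^ d)) ^ d ≠ 0 :=
      pow_ne_zero d (mul_ne_zero (fun h => by simp [h, hd] at hμ) (petalRoot_ne_zero hc hu))
    have h4 := div_petalRoot_pow hc hd hμ (c ^ d / y ^ d)
    rw [div_pow, div_eq_one_iff_eq (pow_ne_zero d hy)]
    rw [div_eq_div_iff h3 (pow_ne_zero d hy)] at h4
    exact (mul_left_cancel₀ (pow_ne_zero d hc) h4).symm)
  filter_upwards [hre, hone, eventually_ne_nhds hx0] with y hy1 hy2 hy3
  rw [mem_petal_iff hc hd hμ]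
  exact ⟨hy1, ((div_eq_one_iff_eq hy3).1 hy2).symm⟩

lemma disjoint_petal (hc : c ≠ 0) (hd : d ≠ 0) (hR : 0 ≤ R) {μ' : ℂ} (hμ : μ ^ d = 1)
    (hμ' : μ' ^ d = 1) (hne : μ ≠ μ') : Disjoint (petal c d R μ) (petal c d R μ') := by
  rw [Set.disjoint_left]
  intro x hx hx'
  have h0 := ne_zero_of_mem_petal hc hd hR hμ hx
  have h1 := ((mem_petal_iff hc hd hμ).1 hx).2
  have h2 := ((mem_petal_iff hc hd hμ').1 hx').2
  rw [h1] at h2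
  refine hne (mul_right_cancel₀ (petalRoot_ne_zero hc ?_) (by rw [← h1] at h2 ⊢; exact h2))
  exact div_ne_zero (pow_ne_zero d hc) (pow_ne_zero d h0)

/-- Both arguments lie in `(-π/2, π/2)`, so their sum stays within the principal range. -/
lemma mul_cpow_of_re_pos {u t : ℂ} (hu : 0 < u.re) (ht : 0 < t.re) (s : ℂ) :
    (u * t) ^ s = u ^ s * t ^ s := by
  have hu0 : u ≠ 0 := by
    rintro rfl
    simp at hu
  have ht0 : t ≠ 0 := by
    rintro rfl
    simp at ht
  have h1 := abs_lt.1 (Complex.abs_arg_lt_pi_div_two_iff.2 (Or.inl hu))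
  have h2 := abs_lt.1 (Complex.abs_arg_lt_pi_div_two_iff.2 (Or.inl ht))
  rw [Complex.cpow_def_of_ne_zero (mul_ne_zero hu0 ht0), Complex.cpow_def_of_ne_zero hu0,
    Complex.cpow_def_of_ne_zero ht0, ← Complex.exp_add, ← add_mul,
    Complex.log_mul hu0 ht0 ⟨by linarith, by linarith⟩]

/-- A multiplication by a number close to `l` maps a petal to the petal rotated by `l`. -/
lemma eventually_mul_mem_petal (hc : c ≠ 0) (hd : d ≠ 0) {l : ℂ} (hl : l ^ d = 1) :
    ∀ᶠ r in 𝓝 (1 : ℂ), ∀ R : ℝ, 0 ≤ R → ∀ μ : ℂ, μ ^ d = 1 → ∀ x ∈ petal c d R μ,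
      R < (c ^ d / (l * x * r) ^ d).re → l * x * r ∈ petal c d R (l * μ) := by
  have h1 : ContinuousAt (fun r : ℂ => (r⁻¹) ^ d) 1 :=
    (continuousAt_inv₀ one_ne_zero).pow d
  have hre : ∀ᶠ r in 𝓝 (1 : ℂ), 0 < ((r⁻¹) ^ d).re :=
    (Complex.continuous_re.continuousAt.comp h1).eventually_const_lt (by simp)
  have h2 : ContinuousAt (fun r : ℂ => ((r⁻¹) ^ d) ^ (-(d : ℂ)⁻¹) / r) 1 :=
    (h1.cpow continuousAt_const (Or.inl (by simp))).div continuousAt_id one_ne_zero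
  have ht : Tendsto (fun r : ℂ => ((r⁻¹) ^ d) ^ (-(d : ℂ)⁻¹) / r) (𝓝 1) (𝓝 1) := by
    have := h2.tendsto
    simpa using this
  have hone := eventually_eq_one_of_pow_eq_one hd ht (by
    filter_upwards [eventually_ne_nhds one_ne_zero] with r hr
    rw [div_pow, cpow_neg_inv_pow hd, inv_pow, inv_inv, div_self (pow_ne_zero d hr)])
  filter_upwards [hre, hone, eventually_ne_nhds one_ne_zero] with r hr1 hr2 hr0 R hR μ hμ x hx hxr
  obtain ⟨h3, h4⟩ := (mem_petal_iff hc hd hμ).1 hx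
  rw [mem_petal_iff hc hd (by rw [mul_pow, hl, hμ, one_mul])]
  refine ⟨hxr, ?_⟩
  have h5 : c ^ d / (l * x * r) ^ d = c ^ d / x ^ d * (r⁻¹) ^ d := by
    rw [mul_pow, mul_pow, hl, one_mul, inv_pow]
    field_simp
  rw [h5, petalRoot, mul_cpow_of_re_pos (by linarith) hr1, (div_eq_one_iff_eq hr0).1 hr2]
  rw [petalRoot] at h4
  linear_combination (l * r) * h4

end Petal

/-! ### Dynamics on the cone where the neutral coordinate dominates. -/

section Cone

open Asymptotics

variable {n : ℕ} [NeZero n]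

/-- The points at which the coordinate function `h` dominates the other coordinates. -/
def dominationCone (h : (Fin n → ℂ) → ℂ) : Set (Fin n → ℂ) :=
  {z | h z ≠ 0 ∧ ∀ j, j ≠ 0 → ‖z j‖ < ‖h z‖}

lemma norm_update_le_of_mem_dominationCone {h : (Fin n → ℂ) → ℂ} {z : Fin n → ℂ}
    (hz : z ∈ dominationCone h) : ‖Function.update z 0 (h z)‖ ≤ ‖h z‖ := by
  rw [pi_norm_le_iff_of_nonneg (norm_nonneg _)]
  intro j
  by_cases hj : j = 0
  · simp [hj]
  · simpa [hj] using (hz.2 j hj).le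

/-- A function with differential `c • dz₀`, `c ≠ 0`, can replace the first coordinate. -/
lemma exists_coordinates {h : (Fin n → ℂ) → ℂ} (hh : AnalyticAt ℂ h 0) (hh0 : h 0 = 0) {c : ℂ}
    (hc : c ≠ 0) (hdh : ∀ v, fderiv ℂ h 0 v = c * v 0) :
    ∃ e : OpenPartialHomeomorph (Fin n → ℂ) (Fin n → ℂ), (0 : Fin n → ℂ) ∈ e.source ∧
      (∀ z, e z = Function.update z 0 (h z)) ∧ e 0 = 0 ∧ e.symm 0 = 0 ∧
      (fun y => ‖e.symm y‖) =O[𝓝 0] fun y => ‖y‖ := by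
  classical
  let Ψ : (Fin n → ℂ) → (Fin n → ℂ) := fun z => Function.update z 0 (h z)
  let u : Fin n → ℂ := fun j => if j = 0 then c else 1
  have hu (j : Fin n) : u j ≠ 0 := by
    by_cases hj : j = 0
    · simpa [u, hj] using hc
    · simp [u, hj]
  have hproj (j : Fin n) : AnalyticAt ℂ (fun z : Fin n → ℂ => z j) 0 :=
    (ContinuousLinearMap.proj (R := ℂ) (φ := fun _ : Fin n => ℂ) j).analyticAt 0
  have hΨ : AnalyticAt ℂ Ψ 0 := by
    refine analyticAt_pi_iff.2 fun j => ?_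
    by_cases hj : j = 0
    · simpa [Ψ, hj] using hh
    · simpa [Ψ, hj] using hproj j
  have hΨ' : HasFDerivAt Ψ (diagonalEquiv u hu : (Fin n → ℂ) →L[ℂ] (Fin n → ℂ)) 0 := by
    refine hasFDerivAt_pi'.2 fun j => ?_
    by_cases hj : j = 0
    · subst hj
      simp only [Ψ, Function.update_self]
      refine hh.differentiableAt.hasFDerivAt.congr_fderiv (ContinuousLinearMap.ext fun v => ?_)
      simp [diagonalEquiv_apply, u, hdh]
    · simp only [Ψ, Function.update_of_ne hj]
      refine (ContinuousLinearMap.proj (R := ℂ) (φ := fun _ : Fin n => ℂ)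
        j).hasFDerivAt.congr_fderiv (ContinuousLinearMap.ext fun v => ?_)
      simp [diagonalEquiv_apply, u, hj]
  have hΨ0 : Ψ 0 = 0 := by
    ext j
    by_cases hj : j = 0
    · simp [Ψ, hj, hh0]
    · simp [Ψ, hj]
  have hs : HasStrictFDerivAt Ψ (diagonalEquiv u hu : (Fin n → ℂ) →L[ℂ] (Fin n → ℂ)) 0 := by
    have := hΨ.hasStrictFDerivAt
    rwa [hΨ'.fderiv] at this
  let e := hs.toOpenPartialHomeomorph Ψ
  have he : ⇑e = Ψ := hs.toOpenPartialHomeomorph_coe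
  have he0 : (0 : Fin n → ℂ) ∈ e.source := hs.mem_toOpenPartialHomeomorph_source
  have hsymm0 : e.symm 0 = 0 := by
    have := e.left_inv he0
    rwa [he, hΨ0] at this
  have hsymm : AnalyticAt ℂ e.symm 0 := by
    have := e.analyticAt_symm' he0 (by rw [he]; exact hΨ) (by rw [he]; exact hΨ'.fderiv)
    rwa [he, hΨ0] at this
  exact ⟨e, he0, fun z => by rw [he], by rw [he, hΨ0], hsymm0,
    isBigO_norm_of_map_zero hsymm.differentiableAt hsymm0⟩

/-- In the coordinates with `h` in place of the first one, the norm of a point of the cone is at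
most `‖h z‖`, and the inverse coordinate change is `O(‖y‖)` at `0`. -/
lemma isBigO_norm_dominationCone {h : (Fin n → ℂ) → ℂ} (hh : AnalyticAt ℂ h 0) (hh0 : h 0 = 0)
    {c : ℂ} (hc : c ≠ 0) (hdh : ∀ v, fderiv ℂ h 0 v = c * v 0) :
    (fun z => ‖z‖) =O[𝓝[dominationCone h] 0] h := by
  obtain ⟨e, he0, he, hz0, -, hO⟩ := exists_coordinates hh hh0 hc hdh
  have ht : Tendsto e (𝓝 0) (𝓝 0) := by
    have := (e.continuousAt he0).tendsto
    rwa [hz0] at this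
  have h1 : (fun z => ‖z‖) =O[𝓝 0] fun z => ‖e z‖ := by
    refine (hO.comp_tendsto ht).congr' ?_ .rfl
    filter_upwards [e.open_source.mem_nhds he0] with z hz
    simp only [Function.comp_apply]
    rw [e.left_inv hz]
  refine (h1.mono nhdsWithin_le_nhds).trans (IsBigO.of_bound 1 ?_)
  filter_upwards [self_mem_nhdsWithin] with z hz
  rw [one_mul, norm_norm, he]
  exact norm_update_le_of_mem_dominationCone hz

variable {F : (Fin n → ℂ) → (Fin n → ℂ)} {lam : Fin n → ℂ} {q : ℕ}

/-- Dynamics of the coordinate `h` on the domination cone near `0`. -/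
lemma IsQuasiParabolic.dominationCone_dynamics (hF : IsQuasiParabolic F lam q) {a : ℂ}
    {d : ℕ} (hd : 1 ≤ d) (hqd : lam 0 ^ d = 1) {h : (Fin n → ℂ) → ℂ}
    (hh : IsSemiconjugacy F (lam 0) a (d + 1) (d + 2) h) {κ : ℂ}
    (hκ : κ * (d * (a / lam 0)) = -1) :
    (∀ᶠ z in 𝓝[dominationCone h] 0, F z ∈ dominationCone h) ∧
    Tendsto (fun z => h (F z) / (lam 0 * h z)) (𝓝[dominationCone h] 0) (𝓝 1) ∧
    Tendsto (fun z => κ / h (F z) ^ d - κ / h z ^ d) (𝓝[dominationCone h] 0) (𝓝 1) := by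
  have hdiff := hF.analyticAt.differentiableAt
  obtain ⟨c, hc, hdh⟩ := hh.exists_hasFDerivAt hdiff hF.map_zero hF.fderiv_apply hF.lam_ne hd
  have hl0 : lam 0 ≠ 0 := hF.isPrimitiveRoot.ne_zero hF.pos.ne'
  set A := dominationCone h with hA
  have hzO := isBigO_norm_dominationCone hh.analyticAt hh.map_zero hc hdh
  have hne : ∀ᶠ z in 𝓝[A] 0, h z ≠ 0 := by
    filter_upwards [self_mem_nhdsWithin] with z hz using hz.1
  have hh0 : Tendsto h (𝓝[A] 0) (𝓝 0) := by
    have := hh.analyticAt.continuousAt.tendsto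
    rw [hh.map_zero] at this
    exact this.mono_left nhdsWithin_le_nhds
  set b := a / lam 0 with hb
  set r : (Fin n → ℂ) → ℂ := fun z => h (F z) / (lam 0 * h z) with hr
  -- On the cone the error is `O(h ^ (d + 2))`; division by `lam 0 * h` leaves `O(h ^ (d + 1))`,
  -- which is `o(h ^ d)`.
  have hrb : (fun z => r z - 1 - b * h z ^ d) =o[𝓝[A] 0] fun z => h z ^ d := by
    have h1 : (fun z => h (F z) - (lam 0 * h z + a * h z ^ (d + 1))) =O[𝓝[A] 0]
        fun z => h z ^ (d + 2) :=
      (hh.isBigO.mono nhdsWithin_le_nhds).trans (hzO.pow (d + 2))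
    have h2 := h1.mul (isBigO_refl (fun z => (lam 0 * h z)⁻¹) (𝓝[A] 0))
    have h3 : (fun z => r z - 1 - b * h z ^ d) =O[𝓝[A] 0]
        fun z => h z ^ (d + 1) * (lam 0)⁻¹ := by
      refine h2.congr' ?_ ?_
      · filter_upwards [hne] with z hz
        simp only [hr, hb]
        field_simp
        ring
      · filter_upwards [hne] with z hz
        field_simp
        ring
    have h4 : (fun z => h z * (lam 0)⁻¹) =o[𝓝[A] 0] fun _ => (1 : ℂ) := by
      rw [isLittleO_one_iff]
      simpa using hh0.mul_const (lam 0)⁻¹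
    refine h3.trans_isLittleO ?_
    have h5 := (isBigO_refl (fun z => h z ^ d) (𝓝[A] 0)).mul_isLittleO h4
    refine (h5.congr_left fun z => ?_).congr_right fun z => ?_
    · ring
    · ring
  have hrO : (fun z => r z - 1) =O[𝓝[A] 0] fun z => h z ^ d :=
    (hrb.isBigO.add ((isBigO_refl _ _).const_mul_left b)).congr_left fun z => by ring
  have hr1 : Tendsto r (𝓝[A] 0) (𝓝 1) := by
    have h1 : Tendsto (fun z => h z ^ d) (𝓝[A] 0) (𝓝 0) := by
      have := hh0.pow d
      rwa [zero_pow (by omega)] at this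
    have h2 := (hrO.trans_tendsto h1).add_const 1
    simpa using h2
  refine ⟨?_, hr1, ?_⟩
  · have hcoord (j : Fin n) (hj : j ≠ 0) : ∀ᶠ z in 𝓝[A] 0, ‖F z j‖ < ‖h (F z)‖ := by
      -- Chosen so that `‖lam j‖ + ε ≤ 1 - ε`: the other coordinates contract more than `h` can.
      set ε := (1 - ‖lam j‖) / 4 with hε
      have hlt := hF.norm_lt_one j hj
      have hε0 : 0 < ε := by linarith
      have h1 : (fun z => F z j - lam j * z j) =o[𝓝[A] 0] h := by
        have h2 := (hasFDerivAt_pi'.1 hdiff.hasFDerivAt j).isLittleO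
        have h3 : (fun z => F z j - lam j * z j) =o[𝓝 0] fun z => ‖z‖ := by
          refine (h2.norm_right.congr_left fun z => ?_).congr_right fun z => ?_
          · simp [hF.map_zero, hF.fderiv_apply]
          · simp
        exact (h3.mono nhdsWithin_le_nhds).trans_isBigO hzO
      have h4 : ∀ᶠ z in 𝓝[A] 0, 1 - ε < ‖r z‖ := by
        refine hr1.norm.eventually_const_lt ?_
        rw [norm_one]
        linarith
      filter_upwards [h1.bound hε0, h4, self_mem_nhdsWithin] with z hz1 hz2 hz3
      have hx : 0 < ‖h z‖ := norm_pos_iff.2 hz3.1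
      have h5 : ‖h (F z)‖ = ‖r z‖ * ‖h z‖ := by
        simp only [hr, norm_div, norm_mul, hF.norm_lam_zero]
        field_simp
      have h6 : ‖F z j‖ ≤ ε * ‖h z‖ + ‖lam j‖ * ‖h z‖ := by
        calc ‖F z j‖ = ‖(F z j - lam j * z j) + lam j * z j‖ := by ring_nf
          _ ≤ ‖F z j - lam j * z j‖ + ‖lam j * z j‖ := norm_add_le _ _
          _ ≤ _ := by
            rw [norm_mul]
            gcongr
            exact (hz3.2 j hj).le
      rw [h5]
      refine h6.trans_lt ?_
      rw [← add_mul]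
      refine mul_lt_mul_of_pos_right (lt_of_le_of_lt ?_ hz2) hx
      linarith
    have hall : ∀ᶠ z in 𝓝[A] 0, ∀ j, j ≠ 0 → ‖F z j‖ < ‖h (F z)‖ := by
      rw [eventually_all]
      intro j
      by_cases hj : j = 0
      · exact .of_forall fun z h => absurd hj h
      · filter_upwards [hcoord j hj] with z hz _ using hz
    have hrne : ∀ᶠ z in 𝓝[A] 0, r z ≠ 0 := hr1.eventually_ne one_ne_zero
    filter_upwards [hall, hrne] with z hz1 hz2
    refine ⟨fun h0 => hz2 ?_, hz1⟩
    simp [hr, h0]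
  -- The increment is `κ h ^ (-d) * (r ^ (-d) - 1)`. Since `r - 1` is `b h ^ d` to leading order and
  -- `x ^ (-d)` has derivative `-d` at `1`, its limit is `-κ d b = 1`.
  · have hder : HasDerivAt (fun x : ℂ => (x⁻¹) ^ d) (-(d : ℂ)) 1 := by
      have := (hasDerivAt_inv (one_ne_zero (α := ℂ))).fun_pow d
      simpa using this
    have h1 := hder.isLittleO.comp_tendsto hr1
    have h2 : (fun z => ((r z)⁻¹) ^ d - 1 + d * (r z - 1)) =o[𝓝[A] 0] fun z => h z ^ d := by
      refine IsLittleO.trans_isBigO ?_ hrO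
      refine h1.congr_left fun z => ?_
      simp
      ring
    have h3 : (fun z => ((r z)⁻¹) ^ d - 1 + d * b * h z ^ d) =o[𝓝[A] 0] fun z => h z ^ d :=
      (h2.sub (hrb.const_mul_left (d : ℂ))).congr_left fun z => by ring
    have h4 := (h3.tendsto_div_nhds_zero.const_mul κ).add_const 1
    rw [mul_zero, zero_add] at h4
    refine h4.congr' ?_
    filter_upwards [hne] with z hz
    have h5 : h (F z) = lam 0 * h z * r z := by
      simp only [hr]
      field_simp
    rw [h5, mul_pow, mul_pow, hqd, one_mul, div_mul_eq_div_div, div_eq_mul_inv (κ / h z ^ d),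
      ← inv_pow]
    have hzd : h z ^ d ≠ 0 := pow_ne_zero d hz
    field_simp
    linear_combination (h z ^ d) * hκ

end Cone

/-! ### Petals of `F` in several variables. -/

section PetalFamily

variable {n : ℕ}

/-- A family of attracting petals of `F` at `0`, indexed by the `d`-th roots of unity, on which
the Fatou coordinate `u` is moved approximately by a unit translation. -/
structure IsPetalFamily (F : (Fin n → ℂ) → (Fin n → ℂ)) (l : ℂ) (d : ℕ) (u : (Fin n → ℂ) → ℂ)
    (D : ℂ → Set (Fin n → ℂ)) : Prop where
  isOpen : ∀ μ, μ ^ d = 1 → IsOpen (D μ)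
  isPreconnected : ∀ μ, μ ^ d = 1 → IsPreconnected (D μ)
  disjoint : ∀ μ μ', μ ^ d = 1 → μ' ^ d = 1 → μ ≠ μ' → Disjoint (D μ) (D μ')
  mapsTo : ∀ μ, μ ^ d = 1 → MapsTo F (D μ) (D (l * μ))
  zero_notMem : ∀ μ, μ ^ d = 1 → (0 : Fin n → ℂ) ∉ D μ
  zero_mem_closure : ∀ μ, μ ^ d = 1 → (0 : Fin n → ℂ) ∈ closure (D μ)
  re_pos : ∀ μ, μ ^ d = 1 → ∀ z ∈ D μ, 0 < (u z).re
  translation : ∀ μ, μ ^ d = 1 → ∀ z ∈ D μ, ‖u (F z) - u z - 1‖ ≤ 1 / 4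
  mem_of_le_norm : ∀ O ∈ 𝓝 (0 : Fin n → ℂ), ∃ R : ℝ, ∀ μ, μ ^ d = 1 → ∀ z ∈ D μ,
    R ≤ ‖u z‖ → z ∈ O
  eventually_lt_norm : ∀ R : ℝ, ∀ᶠ z in 𝓝 (0 : Fin n → ℂ), ∀ μ, μ ^ d = 1 → z ∈ D μ → R < ‖u z‖

/-- The points of the domination cone whose first coordinate is in a petal. -/
def petalDomain [NeZero n] (c : ℂ) (d : ℕ) (R : ℝ) (μ : ℂ) : Set (Fin n → ℂ) :=
  {y | y 0 ∈ petal c d R μ ∧ ∀ j, j ≠ 0 → ‖y j‖ < ‖y 0‖}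

section

variable [NeZero n] {c : ℂ} {d : ℕ} {R : ℝ} {μ : ℂ}

lemma isOpen_petalDomain (hc : c ≠ 0) (hd : d ≠ 0) (hR : 0 ≤ R) (hμ : μ ^ d = 1) :
    IsOpen (petalDomain c d R μ : Set (Fin n → ℂ)) := by
  have h1 : IsOpen {y : Fin n → ℂ | y 0 ∈ petal c d R μ} :=
    (isOpen_petal hc hd hR hμ).preimage (continuous_apply 0)
  have h2 : IsOpen {y : Fin n → ℂ | ∀ j, j ≠ 0 → ‖y j‖ < ‖y 0‖} := by
    simp only [ofPred_forall]
    refine isOpen_iInter_of_finite fun j => isOpen_iInter_of_finite fun _ => ?_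
    exact isOpen_lt (continuous_apply j).norm (continuous_apply 0).norm
  exact h1.inter h2

lemma isPreconnected_petalDomain (hc : c ≠ 0) (hd : d ≠ 0) (hR : 0 ≤ R) (hμ : μ ^ d = 1) :
    IsPreconnected (petalDomain c d R μ : Set (Fin n → ℂ)) := by
  classical
  -- The domain is the continuous image of a convex set, a half-plane times the unit ball: the ball
  -- gives the other coordinates relative to the size of the first, and its own first coordinate is
  -- ignored.
  let Θ : ℂ × (Fin n → ℂ) → (Fin n → ℂ) := fun p j =>
    if j = 0 then μ * petalRoot c d p.1 else (‖μ * petalRoot c d p.1‖ : ℂ) * p.2 j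
  have hdom : IsPreconnected ({u : ℂ | R < u.re} ×ˢ Metric.ball (0 : Fin n → ℂ) 1) :=
    (convex_halfSpace_re_gt R).isPreconnected.prod (convex_ball _ _).isPreconnected
  have hroot : ContinuousOn (fun p : ℂ × (Fin n → ℂ) => μ * petalRoot c d p.1)
      ({u : ℂ | R < u.re} ×ˢ Metric.ball (0 : Fin n → ℂ) 1) := by
    intro p hp
    refine (continuousAt_const.mul ?_).continuousWithinAt
    refine ContinuousAt.comp (g := petalRoot c d) (f := Prod.fst) ?_ continuousAt_fst
    exact continuousAt_petalRoot (hR.trans_lt hp.1)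
  have hcont : ContinuousOn Θ ({u : ℂ | R < u.re} ×ˢ Metric.ball (0 : Fin n → ℂ) 1) := by
    refine continuousOn_pi.2 fun j => ?_
    by_cases hj : j = 0
    · simpa only [Θ, if_pos hj] using hroot
    · simp only [Θ, if_neg hj]
      refine (Complex.continuous_ofReal.comp_continuousOn hroot.norm).mul ?_
      exact ((continuous_apply j).comp continuous_snd).continuousOn
  convert hdom.image Θ hcont using 1
  ext y
  constructor
  · rintro ⟨⟨u, hu, hy⟩, hj⟩
    simp only at hy
    have hy0 : y 0 ≠ 0 := ne_zero_of_mem_petal hc hd hR hμ ⟨u, hu, hy⟩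
    have hpos : 0 < ‖y 0‖ := norm_pos_iff.2 hy0
    refine ⟨(u, fun j => if j = 0 then 0 else y j / ‖y 0‖), ⟨hu, ?_⟩, ?_⟩
    · rw [mem_ball_zero_iff, pi_norm_lt_iff one_pos]
      intro j
      by_cases hj0 : j = 0
      · simp [hj0]
      · simp only [if_neg hj0, norm_div, Complex.norm_real, norm_norm]
        rw [div_lt_one hpos]
        exact hj j hj0
    · ext j
      by_cases hj0 : j = 0
      · simp only [Θ, if_pos hj0]
        rw [hy, hj0]
      · simp only [Θ, if_neg hj0]
        rw [hy, mul_div_cancel₀]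
        exact_mod_cast hpos.ne'
  · rintro ⟨⟨u, ζ⟩, ⟨hu, hζ⟩, rfl⟩
    have hmem : μ * petalRoot c d u ∈ petal c d R μ := ⟨u, hu, rfl⟩
    have hpos : 0 < ‖μ * petalRoot c d u‖ :=
      norm_pos_iff.2 (ne_zero_of_mem_petal hc hd hR hμ hmem)
    refine ⟨by simpa [Θ] using hmem, fun j hj => ?_⟩
    simp only [Θ, if_neg hj, if_true]
    rw [norm_mul, Complex.norm_real, norm_norm]
    refine mul_lt_of_lt_one_right hpos ?_
    exact (norm_le_pi_norm ζ j).trans_lt (mem_ball_zero_iff.1 hζ)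

/-- Where the first coordinate dominates, a large Fatou coordinate forces the whole point to be
small. -/
lemma exists_mem_of_le_norm_div (c : ℂ) {O : Set (Fin n → ℂ)} (hO : O ∈ 𝓝 0) :
    ∃ R : ℝ, 0 < R ∧ ∀ y : Fin n → ℂ, (∀ j, j ≠ 0 → ‖y j‖ < ‖y 0‖) → y 0 ≠ 0 →
      R ≤ ‖c ^ d / y 0 ^ d‖ → y ∈ O := by
  obtain ⟨ε, hε, hball⟩ := Metric.mem_nhds_iff.1 hO
  refine ⟨‖c ^ d‖ / ε ^ d + 1, by positivity, fun y hy hy0 hR => hball ?_⟩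
  rw [mem_ball_zero_iff]
  have hpos : 0 < ‖y 0‖ := norm_pos_iff.2 hy0
  have h1 : ‖y 0‖ < ε := by
    by_contra! hle
    have h2 : ‖c ^ d / y 0 ^ d‖ ≤ ‖c ^ d‖ / ε ^ d := by
      rw [norm_div, norm_pow (y 0)]
      gcongr
    linarith
  refine lt_of_le_of_lt ?_ h1
  rw [pi_norm_le_iff_of_nonneg (norm_nonneg _)]
  intro j
  by_cases hj : j = 0
  · rw [hj]
  · exact (hy j hj).le

end

/-- The petals are pullbacks of the model domains by the coordinates `e`. For invariance, `Re u`
grows, so it stays above `R`, and the ratio `h (F z) / (lam 0 * h z)` is close enough to `1` to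
force the branch `lam 0 * μ`. -/
theorem IsQuasiParabolic.exists_isPetalFamily [NeZero n] {F : (Fin n → ℂ) → (Fin n → ℂ)}
    {lam : Fin n → ℂ} {q : ℕ} (hF : IsQuasiParabolic F lam q) {a : ℂ} (ha : a ≠ 0) {d : ℕ}
    (hd : 1 ≤ d) (hqd : lam 0 ^ d = 1) {h : (Fin n → ℂ) → ℂ}
    (hh : IsSemiconjugacy F (lam 0) a (d + 1) (d + 2) h) :
    ∃ u D, IsPetalFamily F (lam 0) d u D := by
  have hd0 : d ≠ 0 := by omega
  have hl0 : lam 0 ≠ 0 := hF.isPrimitiveRoot.ne_zero hF.pos.ne'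
  have hdiff := hF.analyticAt.differentiableAt
  have hdC : (d : ℂ) ≠ 0 := Nat.cast_ne_zero.2 hd0
  obtain ⟨c', hc', hdh⟩ := hh.exists_hasFDerivAt hdiff hF.map_zero hF.fderiv_apply hF.lam_ne hd
  obtain ⟨e, he0, he, hez, hesymm, -⟩ := exists_coordinates hh.analyticAt hh.map_zero hc' hdh
  obtain ⟨c, hcκ⟩ := IsAlgClosed.exists_pow_nat_eq (-(d * (a / lam 0))⁻¹) hd
  have hκ : c ^ d * (d * (a / lam 0)) = -1 := by
    rw [hcκ]
    field_simp
  have hc : c ≠ 0 := by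
    rintro rfl
    rw [zero_pow hd0, zero_mul] at hκ
    simp at hκ
  obtain ⟨hcone, hratio, htrans⟩ := hF.dominationCone_dynamics hd hqd hh hκ
  set u : (Fin n → ℂ) → ℂ := fun z => c ^ d / h z ^ d with hu
  have hev : ∀ᶠ z in 𝓝 (0 : Fin n → ℂ), z ∈ dominationCone h → F z ∈ dominationCone h ∧
      ‖u (F z) - u z - 1‖ ≤ 1 / 4 ∧ F z ∈ e.source ∧
      ∀ R : ℝ, 0 ≤ R → ∀ μ : ℂ, μ ^ d = 1 → ∀ x ∈ petal c d R μ,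
        R < (c ^ d / (lam 0 * x * (h (F z) / (lam 0 * h z))) ^ d).re →
        lam 0 * x * (h (F z) / (lam 0 * h z)) ∈ petal c d R (lam 0 * μ) := by
    rw [← eventually_nhdsWithin_iff]
    have h1 : ∀ᶠ z in 𝓝[dominationCone h] 0, ‖u (F z) - u z - 1‖ ≤ 1 / 4 := by
      have h2 : Tendsto (fun z => ‖u (F z) - u z - 1‖) (𝓝[dominationCone h] 0) (𝓝 0) := by
        have := (htrans.sub_const 1).norm
        rwa [sub_self, norm_zero] at this
      exact (h2.eventually_lt_const (by norm_num)).mono fun z hz => hz.le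
    have h3 : ∀ᶠ z in 𝓝[dominationCone h] 0, F z ∈ e.source :=
      ((tendsto_of_map_zero hdiff hF.map_zero).eventually
        (e.open_source.mem_nhds he0)).filter_mono nhdsWithin_le_nhds
    filter_upwards [hcone, h1, h3, hratio.eventually (eventually_mul_mem_petal hc hd0 hqd)]
      with z a1 a2 a3 a4
    exact ⟨a1, a2, a3, a4⟩
  have hsymmt : Tendsto e.symm (𝓝 0) (𝓝 0) := by
    have h0 : (0 : Fin n → ℂ) ∈ e.target := by
      rw [← hez]
      exact e.map_source he0
    have := (e.continuousAt_symm h0).tendsto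
    rwa [hesymm] at this
  have htarget : e.target ∈ 𝓝 (0 : Fin n → ℂ) := by
    refine e.open_target.mem_nhds ?_
    rw [← hez]
    exact e.map_source he0
  obtain ⟨W, hW, hWev⟩ := hev.exists_mem
  -- With `R` this large, all model domains lie in the target of `e` and come from the neighbourhood
  -- `W` where the cone estimates hold.
  obtain ⟨R, hR, hRmem⟩ := exists_mem_of_le_norm_div c (d := d) (inter_mem htarget (hsymmt hW))
  let D : ℂ → Set (Fin n → ℂ) := fun μ => e.source ∩ e ⁻¹' petalDomain c d R μ
  have he' (z : Fin n → ℂ) : e z 0 = h z := by rw [he, Function.update_self]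
  have hej (z : Fin n → ℂ) (j : Fin n) (hj : j ≠ 0) : e z j = z j := by
    rw [he, Function.update_of_ne hj]
  have hDh {μ : ℂ} {z : Fin n → ℂ} (hz : z ∈ D μ) : h z ∈ petal c d R μ := by
    have := hz.2.1
    rwa [he'] at this
  have hDre {μ : ℂ} (hμ : μ ^ d = 1) {z : Fin n → ℂ} (hz : z ∈ D μ) : R < (u z).re :=
    ((mem_petal_iff hc hd0 hμ).1 (hDh hz)).1
  have hDne {μ : ℂ} (hμ : μ ^ d = 1) {z : Fin n → ℂ} (hz : z ∈ D μ) : h z ≠ 0 :=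
    ne_zero_of_mem_petal hc hd0 hR.le hμ (hDh hz)
  have hDcone {μ : ℂ} (hμ : μ ^ d = 1) {z : Fin n → ℂ} (hz : z ∈ D μ) : z ∈ dominationCone h := by
    refine ⟨hDne hμ hz, fun j hj => ?_⟩
    have := hz.2.2 j hj
    rwa [he', hej z j hj] at this
  have hYmem {μ : ℂ} (hμ : μ ^ d = 1) {y : Fin n → ℂ} (hy : y ∈ petalDomain c d R μ) :
      y ∈ e.target ∩ e.symm ⁻¹' W := by
    refine hRmem y hy.2 (ne_zero_of_mem_petal hc hd0 hR.le hμ hy.1) ?_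
    exact (((mem_petal_iff hc hd0 hμ).1 hy.1).1.le).trans (Complex.re_le_norm _)
  have hDev {μ : ℂ} (hμ : μ ^ d = 1) {z : Fin n → ℂ} (hz : z ∈ D μ) := hWev z (by
    have := (hYmem hμ hz.2).2
    rwa [mem_preimage, e.left_inv hz.1] at this) (hDcone hμ hz)
  have hDimage {μ : ℂ} (hμ : μ ^ d = 1) : D μ = e.symm '' petalDomain c d R μ :=
    (e.symm_image_eq_source_inter_preimage fun y hy => (hYmem hμ hy).1).symm
  refine ⟨u, D, ⟨?_, ?_, ?_, ?_, ?_, ?_, ?_, ?_, ?_, ?_⟩⟩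
  · intro μ hμ
    exact e.isOpen_inter_preimage (isOpen_petalDomain hc hd0 hR.le hμ)
  · intro μ hμ
    rw [hDimage hμ]
    exact (isPreconnected_petalDomain hc hd0 hR.le hμ).image _
      (e.continuousOn_symm.mono fun y hy => (hYmem hμ hy).1)
  · intro μ μ' hμ hμ' hne
    rw [Set.disjoint_left]
    intro z hz hz'
    exact Set.disjoint_left.1 (disjoint_petal hc hd0 hR.le hμ hμ' hne) (hDh hz) (hDh hz')
  · intro μ hμ z hz
    obtain ⟨b1, b2, b3, b4⟩ := hDev hμ hz
    have hx : lam 0 * h z * (h (F z) / (lam 0 * h z)) = h (F z) :=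
      mul_div_cancel₀ _ (mul_ne_zero hl0 (hDne hμ hz))
    have hre : R < (u (F z)).re := by
      have h1 := hDre hμ hz
      have h2 := (abs_le.1 ((Complex.abs_re_le_norm _).trans b2)).1
      simp only [Complex.sub_re, Complex.one_re] at h2
      linarith
    have h3 := b4 R hR.le μ hμ (h z) (hDh hz) (by rw [hx]; exact hre)
    rw [hx] at h3
    refine ⟨b3, ?_, fun j hj => ?_⟩
    · rwa [he']
    · rw [he', hej _ j hj]
      exact b1.2 j hj
  · intro μ hμ h0
    exact hDne hμ h0 hh.map_zero
  · intro μ hμ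
    rw [mem_closure_iff_nhds]
    intro O hO
    obtain ⟨R', hR', hmem⟩ := exists_mem_of_le_norm_div c (d := d) (hsymmt hO)
    -- The Fatou coordinate of this point is `R + R'`: more than `R`, to be in the petal, and at
    -- least `R'`, to be in `O`.
    let x : ℂ := μ * petalRoot c d ((R + R' : ℝ) : ℂ)
    have hx : x ∈ petal c d R μ := by
      refine ⟨_, ?_, rfl⟩
      rw [mem_ofPred_eq, Complex.ofReal_re]
      linarith
    have hx0 := ne_zero_of_mem_petal hc hd0 hR.le hμ hx
    have hy : (Pi.single 0 x : Fin n → ℂ) ∈ petalDomain c d R μ := by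
      refine ⟨by simpa using hx, fun j hj => ?_⟩
      simpa [hj] using hx0
    refine ⟨e.symm (Pi.single 0 x), ?_, ?_⟩
    · refine hmem _ hy.2 (by simpa using hx0) ?_
      rw [Pi.single_eq_same, div_petalRoot_pow hc hd0 hμ, Complex.norm_real,
        Real.norm_of_nonneg (by linarith)]
      linarith
    · rw [hDimage hμ]
      exact mem_image_of_mem _ hy
  · intro μ hμ z hz
    exact hR.trans (hDre hμ hz)
  · intro μ hμ z hz
    exact (hDev hμ hz).2.1
  · intro O hO
    obtain ⟨R', -, hmem⟩ := exists_mem_of_le_norm_div c (d := d) (hsymmt hO)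
    refine ⟨R', fun μ hμ z hz hle => ?_⟩
    have := hmem (e z) hz.2.2 (by rw [he']; exact hDne hμ hz) (by rwa [he'])
    rwa [mem_preimage, e.left_inv hz.1] at this
  · intro R'
    have h1 : Tendsto (fun z => R' * ‖h z‖ ^ d) (𝓝 0) (𝓝 0) := by
      have h2 : Tendsto (fun z => R' * ‖h z‖ ^ d) (𝓝 0) (𝓝 (R' * ‖h 0‖ ^ d)) :=
        ((hh.analyticAt.continuousAt.norm.pow d).const_mul R').tendsto
      rwa [hh.map_zero, norm_zero, zero_pow hd0, mul_zero] at h2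
    have h3 : 0 < ‖c ^ d‖ := norm_pos_iff.2 (pow_ne_zero d hc)
    filter_upwards [h1.eventually_lt_const h3] with z hz μ hμ hzD
    have h4 : 0 < ‖h z‖ := norm_pos_iff.2 (hDne hμ hzD)
    simp only [hu]
    rw [norm_div, norm_pow (h z), lt_div_iff₀ (by positivity)]
    exact hz

end PetalFamily

/-! ### Cycles of petals as basins of attraction. -/

section Basins

lemma connectedComponentIn_iUnion_eq {X ι : Type*} [TopologicalSpace X] {D : ι → Set X}
    (hopen : ∀ i, IsOpen (D i)) (hconn : ∀ i, IsPreconnected (D i))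
    (hdisj : Pairwise fun i j => Disjoint (D i) (D j)) {i : ι} {x : X} (hx : x ∈ D i) :
    connectedComponentIn (⋃ j, D j) x = D i := by
  have hxU : x ∈ ⋃ j, D j := mem_iUnion.2 ⟨i, hx⟩
  refine Subset.antisymm ?_
    ((hconn i).subset_connectedComponentIn hx (subset_iUnion D i))
  have hrest : IsOpen (⋃ j ∈ {j | j ≠ i}, D j) := isOpen_biUnion fun j _ => hopen j
  refine isPreconnected_connectedComponentIn.subset_left_of_subset_union (hopen i) hrest ?_ ?_
    ⟨x, mem_connectedComponentIn hxU, hx⟩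
  · rw [Set.disjoint_iUnion₂_right]
    exact fun j hj => hdisj (Ne.symm hj)
  · intro y hy
    obtain ⟨j, hj⟩ := mem_iUnion.1 (connectedComponentIn_subset _ _ hy)
    by_cases hji : j = i
    · exact Or.inl (hji ▸ hj)
    · exact Or.inr (mem_biUnion (show j ∈ {j | j ≠ i} from hji) hj)

variable {n : ℕ} {F : (Fin n → ℂ) → (Fin n → ℂ)} {l : ℂ} {d q : ℕ} {u : (Fin n → ℂ) → ℂ}
  {D : ℂ → Set (Fin n → ℂ)}

/-- The union of the petals in a cycle. -/
def petalCycle (D : ℂ → Set (Fin n → ℂ)) (l : ℂ) (q : ℕ) (ν : ℂ) : Set (Fin n → ℂ) :=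
  ⋃ p : ZMod q, D (l ^ p.val * ν)

namespace IsPetalFamily

lemma root_pow (hl : l ^ d = 1) {ν : ℂ} (hν : ν ^ d = 1) (m : ℕ) : (l ^ m * ν) ^ d = 1 := by
  rw [mul_pow, ← pow_mul, mul_comm m d, pow_mul, hl, one_pow, one_mul, hν]

lemma pow_val_add_one (hq : 0 < q) (hlq : l ^ q = 1) (p : ZMod q) :
    l ^ (p + 1).val = l * l ^ p.val := by
  have : NeZero q := ⟨hq.ne'⟩
  rw [← pow_succ']
  refine pow_eq_pow_of_modEq ?_ hlq
  rw [← ZMod.natCast_eq_natCast_iff]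
  simp

lemma mapsTo_cycle (hP : IsPetalFamily F l d u D) (hq : 0 < q) (hlq : l ^ q = 1)
    (hl : l ^ d = 1) {ν : ℂ} (hν : ν ^ d = 1) (p : ZMod q) :
    MapsTo F (D (l ^ p.val * ν)) (D (l ^ (p + 1).val * ν)) := by
  rw [pow_val_add_one hq hlq, mul_assoc]
  exact hP.mapsTo _ (root_pow hl hν _)

lemma exists_of_mem_petalCycle (hl : l ^ d = 1) {ν : ℂ} (hν : ν ^ d = 1) {z : Fin n → ℂ}
    (hz : z ∈ petalCycle D l q ν) : ∃ μ, μ ^ d = 1 ∧ z ∈ D μ := by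
  obtain ⟨p, hp⟩ := mem_iUnion.1 hz
  exact ⟨_, root_pow hl hν _, hp⟩

lemma mapsTo_petalCycle (hP : IsPetalFamily F l d u D) (hq : 0 < q) (hlq : l ^ q = 1)
    (hl : l ^ d = 1) {ν : ℂ} (hν : ν ^ d = 1) :
    MapsTo F (petalCycle D l q ν) (petalCycle D l q ν) := by
  intro z hz
  obtain ⟨p, hp⟩ := mem_iUnion.1 hz
  exact mem_iUnion.2 ⟨p + 1, hP.mapsTo_cycle hq hlq hl hν p hp⟩

lemma re_add_le (hP : IsPetalFamily F l d u D) {μ : ℂ} (hμ : μ ^ d = 1) {z : Fin n → ℂ}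
    (hz : z ∈ D μ) : (u z).re + 3 / 4 ≤ (u (F z)).re := by
  have h1 := (abs_le.1 ((Complex.abs_re_le_norm _).trans (hP.translation μ hμ z hz))).1
  simp only [Complex.sub_re, Complex.one_re] at h1
  linarith

/-- The real part gains at least `3/4` while `|Im u|` loses at most `1/4`. The translation bound
alone does not make `‖u‖` increase, so this comparable quantity is used to define invariant
neighbourhoods. -/
lemma re_add_abs_im_lt (hP : IsPetalFamily F l d u D) {μ : ℂ} (hμ : μ ^ d = 1) {z : Fin n → ℂ}
    (hz : z ∈ D μ) : (u z).re + |(u z).im| < (u (F z)).re + |(u (F z)).im| := by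
  have h1 := hP.re_add_le hμ hz
  have h2 := (Complex.abs_im_le_norm _).trans (hP.translation μ hμ z hz)
  simp only [Complex.sub_im, Complex.one_im, sub_zero] at h2
  have h3 := abs_sub_abs_le_abs_sub (u z).im (u (F z)).im
  rw [abs_sub_comm] at h3
  linarith

lemma isOpen_petalCycle (hP : IsPetalFamily F l d u D) (hl : l ^ d = 1) {ν : ℂ}
    (hν : ν ^ d = 1) : IsOpen (petalCycle D l q ν) :=
  isOpen_iUnion fun _ => hP.isOpen _ (root_pow hl hν _)

lemma zero_mem_closure_petalCycle (hP : IsPetalFamily F l d u D) (hl : l ^ d = 1) {ν : ℂ}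
    (hν : ν ^ d = 1) : (0 : Fin n → ℂ) ∈ closure (petalCycle D l q ν) :=
  closure_mono (subset_iUnion (fun p : ZMod q => D (l ^ p.val * ν)) 0)
    (hP.zero_mem_closure _ (root_pow hl hν _))

lemma zero_mem_frontier_petalCycle (hP : IsPetalFamily F l d u D) (hl : l ^ d = 1) {ν : ℂ}
    (hν : ν ^ d = 1) : (0 : Fin n → ℂ) ∈ frontier (petalCycle D l q ν) := by
  rw [(hP.isOpen_petalCycle hl hν).frontier_eq]
  refine ⟨hP.zero_mem_closure_petalCycle hl hν, fun h0 => ?_⟩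
  obtain ⟨μ, hμ, h1⟩ := exists_of_mem_petalCycle hl hν h0
  exact hP.zero_notMem μ hμ h1

lemma tendsto_iterate (hP : IsPetalFamily F l d u D) (hq : 0 < q) (hlq : l ^ q = 1)
    (hl : l ^ d = 1) {ν : ℂ} (hν : ν ^ d = 1) {z : Fin n → ℂ} (hz : z ∈ petalCycle D l q ν) :
    Tendsto (fun i : ℕ => F^[i] z) atTop (𝓝 0) := by
  have hmem (i : ℕ) : F^[i] z ∈ petalCycle D l q ν :=
    (hP.mapsTo_petalCycle hq hlq hl hν).iterate i hz
  have hre (i : ℕ) : (i : ℝ) * (3 / 4) ≤ (u (F^[i] z)).re := by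
    induction i with
    | zero =>
      obtain ⟨μ, hμ, h1⟩ := exists_of_mem_petalCycle hl hν hz
      simpa using (hP.re_pos μ hμ z h1).le
    | succ i ih =>
      obtain ⟨μ, hμ, h1⟩ := exists_of_mem_petalCycle hl hν (hmem i)
      have := hP.re_add_le hμ h1
      rw [Function.iterate_succ_apply']
      push_cast
      linarith
  intro O hO
  obtain ⟨R, hR⟩ := hP.mem_of_le_norm O hO
  -- For `i ≥ 2 * R` the lower bound `3 * i / 4` on the real part is at least `R`.
  obtain ⟨N, hN⟩ := exists_nat_ge (R * 2)
  rw [mem_map]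
  filter_upwards [eventually_ge_atTop N] with i hi
  obtain ⟨μ, hμ, h1⟩ := exists_of_mem_petalCycle hl hν (hmem i)
  refine hR μ hμ _ h1 ?_
  have h2 : (N : ℝ) ≤ i := by exact_mod_cast hi
  have h3 : (0 : ℝ) ≤ i := Nat.cast_nonneg i
  have h4 := (hre i).trans (Complex.re_le_norm _)
  linarith

lemma isBasin_petalCycle (hP : IsPetalFamily F l d u D) (hq : 0 < q) (hlq : l ^ q = 1)
    (hl : l ^ d = 1) {ν : ℂ} (hν : ν ^ d = 1) : IsBasin F (petalCycle D l q ν) := by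
  set B := petalCycle D l q ν with hB
  have hcl := hP.zero_mem_closure_petalCycle (q := q) hl hν
  refine ⟨closure_nonempty_iff.1 ⟨0, hcl⟩, hP.isOpen_petalCycle hl hν, hcl,
    {Ω | Ω ∈ 𝓝 0 ∧ MapsTo F (B ∩ Ω) (B ∩ Ω)}, ?_, fun Ω hΩ =>
      ⟨hΩ.2, fun z hz => hP.tendsto_iterate hq hlq hl hν hz.1⟩⟩
  refine ⟨fun t => ⟨fun ht => ?_, fun ⟨Ω, hΩ, hΩt⟩ => mem_of_superset hΩ.1 hΩt⟩⟩
  obtain ⟨R, hR⟩ := hP.mem_of_le_norm t ht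
  -- The factor `2` is enough because `Re u` and `|Im u|` are each at most `‖u‖`.
  let C : Set (Fin n → ℂ) := {z | z ∈ B ∧ 2 * R < (u z).re + |(u z).im|}
  have hCt : C ⊆ t := by
    rintro z ⟨hzB, hz⟩
    obtain ⟨μ, hμ, h1⟩ := exists_of_mem_petalCycle hl hν hzB
    refine hR μ hμ z h1 ?_
    have h2 := Complex.re_le_norm (u z)
    have h3 := Complex.abs_im_le_norm (u z)
    linarith
  -- Invariance concerns only the part inside `B`, which is the superlevel set `C`; outside `B` all
  -- of `t` is kept in order to have a neighbourhood of `0`.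
  refine ⟨(t \ B) ∪ C, ⟨?_, ?_⟩, union_subset sdiff_subset hCt⟩
  · filter_upwards [ht, hP.eventually_lt_norm (2 * R)] with z hzt hz
    by_cases hzB : z ∈ B
    · right
      refine ⟨hzB, ?_⟩
      obtain ⟨μ, hμ, h1⟩ := exists_of_mem_petalCycle hl hν hzB
      have h2 := Complex.norm_le_abs_re_add_abs_im (u z)
      rw [abs_of_pos (hP.re_pos μ hμ z h1)] at h2
      exact (hz μ hμ h1).trans_le h2
    · exact Or.inl ⟨hzt, hzB⟩
  · rintro z ⟨hzB, hz⟩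
    have hzC : z ∈ C := hz.resolve_left fun h => h.2 hzB
    obtain ⟨μ, hμ, h1⟩ := exists_of_mem_petalCycle hl hν hzB
    have hFB := hP.mapsTo_petalCycle hq hlq hl hν hzB
    exact ⟨hFB, Or.inr ⟨hFB, hzC.2.trans (hP.re_add_abs_im_lt hμ h1)⟩⟩

lemma permutesComponentsCyclically (hP : IsPetalFamily F l d u D) (hq : 0 < q)
    (hlq : IsPrimitiveRoot l q) (hl : l ^ d = 1) {ν : ℂ} (hν0 : ν ≠ 0) (hν : ν ^ d = 1) :
    PermutesComponentsCyclically F q (petalCycle D l q ν) := by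
  have : NeZero q := ⟨hq.ne'⟩
  have hinj : Function.Injective fun p : ZMod q => l ^ p.val * ν := by
    intro p p' h
    exact ZMod.val_injective q
      (hlq.pow_inj (ZMod.val_lt p) (ZMod.val_lt p') (mul_right_cancel₀ hν0 h))
  have hdisj : Pairwise fun p p' : ZMod q => Disjoint (D (l ^ p.val * ν)) (D (l ^ p'.val * ν)) :=
    fun p p' hpp => hP.disjoint _ _ (root_pow hl hν _) (root_pow hl hν _) (hinj.ne hpp)
  have hne (p : ZMod q) : (D (l ^ p.val * ν)).Nonempty :=
    closure_nonempty_iff.1 ⟨0, hP.zero_mem_closure _ (root_pow hl hν _)⟩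
  have hcomp (p : ZMod q) (x : Fin n → ℂ) (hx : x ∈ D (l ^ p.val * ν)) :
      connectedComponentIn (petalCycle D l q ν) x = D (l ^ p.val * ν) :=
    connectedComponentIn_iUnion_eq (D := fun p : ZMod q => D (l ^ p.val * ν))
      (fun p => hP.isOpen _ (root_pow hl hν _)) (fun p => hP.isPreconnected _ (root_pow hl hν _))
      hdisj hx
  refine ⟨fun p => D (l ^ p.val * ν), ?_, ?_, hP.mapsTo_cycle hq hlq.pow_eq_one hl hν⟩
  · intro p p' h
    by_contra hpp
    have h1 : Disjoint (D (l ^ p.val * ν)) (D (l ^ p'.val * ν)) := hdisj hpp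
    simp only at h
    rw [h, disjoint_self] at h1
    exact (hne p').ne_empty h1
  · ext C
    constructor
    · rintro ⟨p, rfl⟩
      obtain ⟨x, hx⟩ := hne p
      exact ⟨x, mem_iUnion.2 ⟨p, hx⟩, (hcomp p x hx).symm⟩
    · rintro ⟨x, hx, rfl⟩
      obtain ⟨p, hp⟩ := mem_iUnion.1 hx
      exact ⟨p, (hcomp p x hp).symm⟩

end IsPetalFamily

/-- The powers `ζ ^ i` with `i < k` represent the `k` orbits of multiplication by `lam 0` on the
roots of unity of order `q * k`. -/
theorem IsQuasiParabolic.exists_basins [NeZero n] {lam : Fin n → ℂ}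
    (hF : IsQuasiParabolic F lam q) {k : ℕ}
    (hk : HasResonantForm F lam 1 (Finsupp.single 0 q) k) :
    ∃ B : Fin k → Set (Fin n → ℂ), Pairwise (fun i j => Disjoint (B i) (B j)) ∧
      ∀ i, IsBasin F (B i) ∧ (0 : Fin n → ℂ) ∈ frontier (B i) ∧
        PermutesComponentsCyclically F q (B i) := by
  obtain ⟨a, ha, h, hh⟩ := hk.exists_isSemiconjugacy hF.map_zero
  have hd : 1 ≤ q * k := Nat.mul_pos hF.pos hk.1
  have hl := hF.pow_mul_eq_one k
  obtain ⟨u, D, hP⟩ := hF.exists_isPetalFamily ha hd hl hh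
  set ζ := Complex.exp (2 * Real.pi * Complex.I / (q * k : ℕ)) with hζ
  have hprim : IsPrimitiveRoot ζ (q * k) := Complex.isPrimitiveRoot_exp (q * k) (by omega)
  have hζ0 : ζ ≠ 0 := hprim.ne_zero (by omega)
  have hζpow (i : ℕ) : (ζ ^ i) ^ (q * k) = 1 := by
    rw [← pow_mul, mul_comm, pow_mul, hprim.pow_eq_one, one_pow]
  have hlq := hF.isPrimitiveRoot.pow_eq_one
  refine ⟨fun i => petalCycle D (lam 0) q (ζ ^ i.val), fun i j hij => ?_, fun i =>
    ⟨hP.isBasin_petalCycle hF.pos hlq hl (hζpow i), hP.zero_mem_frontier_petalCycle hl (hζpow i),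
      hP.permutesComponentsCyclically hF.pos hF.isPrimitiveRoot hl (pow_ne_zero _ hζ0) (hζpow i)⟩⟩
  simp only [petalCycle, Set.disjoint_iUnion_left, Set.disjoint_iUnion_right]
  intro p p'
  refine hP.disjoint _ _ (IsPetalFamily.root_pow hl (hζpow _) _)
    (IsPetalFamily.root_pow hl (hζpow _) _) fun heq => hij ?_
  have hlpow (m : ℕ) : (lam 0 ^ m) ^ q = 1 := by
    rw [← pow_mul, mul_comm, pow_mul, hlq, one_pow]
  -- Raising to the power `q` removes the factors `lam 0 ^ p`, and `ζ ^ q` is a primitive `k`-th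
  -- root of unity, so the exponents below `k` are separated.
  have h1 := congrArg (· ^ q) heq
  simp only [mul_pow, hlpow, one_mul] at h1
  rw [← pow_mul, ← pow_mul, mul_comm i.val, mul_comm j.val, pow_mul, pow_mul] at h1
  exact Fin.ext ((hprim.pow (by omega) rfl).pow_inj i.2 j.2 h1)

end Basins

theorem corollary6p1 (n : ℕ) [NeZero n] (F : (Fin n → ℂ) → (Fin n → ℂ)) (hF : IsDiffGerm F)
    (lam : Fin n → ℂ) (hdiag : ∀ v j, fderiv ℂ F 0 v j = lam j * v j)
    (q : ℕ) (hq : 0 < q) (hprim : IsPrimitiveRoot (lam 0) q)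
    (hattr : ∀ j : Fin n, j ≠ 0 → ‖lam j‖ < 1) :
    -- `F` is one-resonant with respect to the first eigenvalue, with index `(q, 0, …, 0)`
    IsOneResonant lam 1 (Finsupp.single 0 q) ∧
    -- the order does not depend on the choice of the resonant form
    (∀ k : ℕ, HasResonantForm F lam 1 (Finsupp.single 0 q) k →
      resonanceOrder F lam 1 (Finsupp.single 0 q) = k) ∧
    -- finite order
    (∀ k : ℕ, resonanceOrder F lam 1 (Finsupp.single 0 q) = k →
      ∃ B : Fin k → Set (Fin n → ℂ), Pairwise (fun i j => Disjoint (B i) (B j)) ∧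
        ∀ i, IsBasin F (B i) ∧ (0 : Fin n → ℂ) ∈ frontier (B i) ∧
          PermutesComponentsCyclically F q (B i)) ∧
    -- infinite order
    (resonanceOrder F lam 1 (Finsupp.single 0 q) = ⊤ ↔ FormallyLinearizable F lam 1) ∧
    (FormallyLinearizable F lam 1 ↔ HasFixedCurve F^[q]) := by
  have hQ : IsQuasiParabolic F lam q := ⟨hF.1, hF.2.1, hdiag, hq, hprim, hattr⟩
  exact ⟨hQ.isOneResonant, fun _ hk => hQ.resonanceOrder_eq hk,
    fun _ hk => hQ.exists_basins (hQ.hasResonantForm_of_resonanceOrder_eq hk),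
    hQ.resonanceOrder_eq_top_iff, hQ.formallyLinearizable_iff_hasFixedCurve⟩
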